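/- All statements are local at the origin of $\mathbb R^n$, $n\ge 1$; "smooth" means $C^\infty$ in a neighborhood of $0$. Consider a system $$\dot\xi = F(\xi)+G(\xi)u,\qquad \xi\in\mathbb R^n,\ u\in\mathbb R,$$ with smooth vector fields $F,G$, $F(0)=0$, $G(0)\neq 0$. **Lower triangular forms.** A system $\dot x=f(x)+g(x)v$ with $f,g$ smooth is a lower triangular form if, near $0$, $f_i$ depends only on $x_1,\dots,x_{i+1}$ and $g_i=0$ for $1\le i\le n-1$, if $g_n(0)\ne 0$, and if for each $1\le i\le n-1$ the function $\partial f_i/\partial x_{i+1}$ is not identically zero on any nonempty open subset of some neighborhood of $0$. The system $(F,G)$ is locally feedback equivalent to $(f,g)$ if there are a local diffeomorphism $x=T(\xi)$ with $T(0)=0$ and a feedback $u=a(\xi)+b(\xi)v$ with $a,b$ smooth, $b(0)\ne0$, that transform the first system into the second one near $0$. **Multi-indices.** A proper $k$-multi-index is $\alpha=(\alpha_1,\dots,\alpha_k)\in\mathbb N^k$ with $\alpha_k\ge 1$. Write $\alpha\lessdot\beta$ if $\alpha$ precedes $\beta$ lexicographically, i.e. $\alpha_i<\beta_i$ at the first place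 where they differ. For a smooth function $p$, $\mathcal L_k(p)$ is, if it exists, the $\lessdot$-least proper $k$-multi-index $\alpha$ with $\partial^\alpha p(0)\neq0$. **The flag.** Put $[V,W]=\mathrm{ad}_VW$ (Lie bracket, $[V,W]=DW\,V-DV\,W$). A flag of the system consists of smooth involutive distributions $D^l$ of constant dimension $n-l+1$ near $0$, $l=1,\dots,n+1$, with $D^{n+1}=0$ and $D^n=\mathrm{span}\{G\}$, for which there are smooth vector fields $G^{i+1}$ $(1\le i\le n-1)$ that are sections of $D^{i+1}$ but not of $D^{i+2}$, such that, with $\hat D^n=\mathrm{span}\{G\}$ and $\hat D^i=\mathrm{span}\{\mathrm{ad}_{G^{i+1}}F,\hat D^{i+1}\}$, for each $1\le i\le n-1$ one has $D^i=\hat D^i$ on an open set whose closure is a neighborhood of $0$. **Adapted data.** These are a flag $(D^l)$ of the system, smooth vector fields $X^1,\dots,X^n$ with $X^l\in D^l$ and $X^l(0)\notin D^{l+1}(0)$, and a tuple $Y=(Y^1,\dots,Y^n)$ of smooth vector fields with $D^k=\mathrm{span}\{Y^k,\dots,Y^n\}$ near $0$ for all $k$ and $[X^l,Y^k]\in D^l$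 for all $l>k$. Write $\mathrm{ad}_Y^\alpha F=\mathrm{ad}_{Y^1}^{\alpha_1}\cdots\mathrm{ad}_{Y^k}^{\alpha_k}F$. **Statement.** For $i=1,\dots,n-1$ let $\alpha^i$ be a proper $(i+1)$-multi-index. The system $(F,G)$ is locally feedback equivalent to a lower triangular form with $\mathcal L_{i+1}(f_i)=\alpha^i$ for all $i=1,\dots,n-1$ if and only if (i) it is locally feedback equivalent to some lower triangular form, and (ii) for all adapted data $(D,X,Y)$ and all $i=1,\dots,n-1$: $\mathrm{ad}_Y^{\alpha^i}F(0)\notin D^{i+1}(0)$, and $\mathrm{ad}_Y^{\alpha}F(0)\in D^{i+1}(0)$ for every proper $(i+1)$-multi-index $\alpha\lessdot\alpha^i$. The equivalence also holds if in (ii) "for all adapted data" is replaced by "for some adapted data", so that a single choice of $(D,X,Y)$ decides the question. -/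

import Mathlib

open Filter Topology
open scoped ContDiff

noncomputable section

namespace LTF

/-! Everything is local at the origin. The state space is `ℝ^n`, written `Fin n → ℝ`, mostly with
`n = m + 1`. Coordinates are numbered from `0`: the classical `x_i` (`1 ≤ i ≤ n`) is `x (i - 1)`.
An index `i : Fin m` stands for the classical `i + 1 ∈ {1, …, n - 1}`; the coordinates `i.castSucc`
and `i.succ` of `Fin (m + 1)` are then the classical `x_{i+1}` and `x_{i+2}`. -/

/-- A map is smooth on some neighborhood of the origin. -/
def SmoothNear {A B : Type*} [NormedAddCommGroup A] [NormedSpace ℝ A]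
    [NormedAddCommGroup B] [NormedSpace ℝ B] (h : A → B) : Prop :=
  ∀ᶠ x in 𝓝 (0 : A), ContDiffAt ℝ ∞ h x

/-! ### Multi-indices -/

/-- `α` is a proper multi-index with last nonzero entry at position `k`. A multi-index with fewer
than `n` entries is identified with its extension by zeros. -/
def IsProper {n : ℕ} (k : Fin n) (α : Fin n → ℕ) : Prop :=
  1 ≤ α k ∧ ∀ l, k < l → α l = 0

/-- `α` is less than `β` in lexicographical order (the first entry is the most significant). -/
def LexLT {n : ℕ} (α β : Fin n → ℕ) : Prop :=
  ∃ i, α i < β i ∧ ∀ j, j < i → α j = β j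

/-- The partial derivative `∂p/∂x_k`. -/
def partialDeriv {n : ℕ} (k : Fin n) (p : (Fin n → ℝ) → ℝ) : (Fin n → ℝ) → ℝ :=
  fun x => fderiv ℝ p x (Pi.single k 1)

/-- The mixed partial derivative `∂^α p = ∂_1^{α_1} ⋯ ∂_n^{α_n} p`. -/
def mixedPartial {n : ℕ} (α : Fin n → ℕ) (p : (Fin n → ℝ) → ℝ) : (Fin n → ℝ) → ℝ :=
  (List.finRange n).foldr (fun k q => (partialDeriv k)^[α k] q) p

/-- The set of the proper multi-indices of `p` with last nonzero entry at position `k`. -/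
def properIndices {n : ℕ} (k : Fin n) (p : (Fin n → ℝ) → ℝ) : Set (Fin n → ℕ) :=
  {α | IsProper k α ∧ mixedPartial α p 0 ≠ 0}

/-- `α` is the least one among the proper multi-indices of `p` with last nonzero entry at `k`. -/
def IsLeastIndex {n : ℕ} (k : Fin n) (p : (Fin n → ℝ) → ℝ) (α : Fin n → ℕ) : Prop :=
  α ∈ properIndices k p ∧ ∀ β ∈ properIndices k p, β ≠ α → LexLT α β

/-! ### Lower triangular forms and feedback equivalence -/

/-- The system `ẋ = f(x) + g(x) v` is a lower triangular form near the origin: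
`f_i` (`i < n`) depends on `x_1, …, x_{i+1}` only, `∂f_i/∂x_{i+1}` does not vanish identically on
any nonempty open subset of some neighborhood of the origin, `g_1 = ⋯ = g_{n-1} = 0`, and
`g_n(0) ≠ 0`. -/
structure IsLowerTriangular {m : ℕ} (f g : (Fin (m + 1) → ℝ) → (Fin (m + 1) → ℝ)) : Prop where
  smooth_f : SmoothNear f
  smooth_g : SmoothNear g
  depends : ∀ i : Fin m, ∃ U ∈ 𝓝 (0 : Fin (m + 1) → ℝ), ∀ x ∈ U, ∀ y ∈ U,
    (∀ k, k ≤ i.succ → x k = y k) → f x i.castSucc = f y i.castSucc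
  nondegenerate : ∀ i : Fin m, ∃ U ∈ 𝓝 (0 : Fin (m + 1) → ℝ), ∀ V ⊆ U, IsOpen V → V.Nonempty →
    ∃ x ∈ V, partialDeriv i.succ (fun y => f y i.castSucc) x ≠ 0
  g_eq_zero : ∀ i : Fin m, ∀ᶠ x in 𝓝 (0 : Fin (m + 1) → ℝ), g x i.castSucc = 0
  g_last : g 0 (Fin.last m) ≠ 0

/-- A local change of coordinates at the origin: a smooth bijection between open neighborhoods of
the origin, with smooth inverse, that fixes the origin. -/
structure IsCoordChange {n : ℕ} (T : OpenPartialHomeomorph (Fin n → ℝ) (Fin n → ℝ)) : Prop where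
  zero_mem : 0 ∈ T.source
  map_zero : T 0 = 0
  smooth : ContDiffOn ℝ ∞ T T.source
  smooth_symm : ContDiffOn ℝ ∞ T.symm T.target

/-- `ξ̇ = F(ξ) + G(ξ) u` is locally transformed into `ẋ = f(x) + g(x) v` by a feedback
`u = a(ξ) + b(ξ) v` with `b(0) ≠ 0` and a change of coordinates `x = T(ξ)`. -/
def FeedbackEquivalent {n : ℕ} (F G f g : (Fin n → ℝ) → (Fin n → ℝ)) : Prop :=
  ∃ (T : OpenPartialHomeomorph (Fin n → ℝ) (Fin n → ℝ)) (a b : (Fin n → ℝ) → ℝ),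
    IsCoordChange T ∧ SmoothNear a ∧ SmoothNear b ∧ b 0 ≠ 0 ∧
    ∀ᶠ ξ in 𝓝 (0 : Fin n → ℝ),
      fderiv ℝ T ξ (F ξ + a ξ • G ξ) = f (T ξ) ∧ fderiv ℝ T ξ (b ξ • G ξ) = g (T ξ)

/-- The system is locally feedback equivalent to some lower triangular form. -/
def Triangularizable {m : ℕ} (F G : (Fin (m + 1) → ℝ) → (Fin (m + 1) → ℝ)) : Prop :=
  ∃ f g, IsLowerTriangular f g ∧ FeedbackEquivalent F G f g

/-- The system is locally feedback equivalent to a lower triangular form whose `i`th right-hand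
side has the least multi-index `α i`, for all `i < n`. -/
def EquivalentToType {m : ℕ} (F G : (Fin (m + 1) → ℝ) → (Fin (m + 1) → ℝ))
    (α : Fin m → Fin (m + 1) → ℕ) : Prop :=
  ∃ f g, IsLowerTriangular f g ∧
    (∀ i : Fin m, IsLeastIndex i.succ (fun x => f x i.castSucc) (α i)) ∧
    FeedbackEquivalent F G f g

/-! ### Distributions and iterated Lie brackets -/

/-- The vector field `V` takes its values in the distribution `D` near the origin. -/
def SectionNear {n : ℕ} (V : (Fin n → ℝ) → (Fin n → ℝ))
    (D : (Fin n → ℝ) → Submodule ℝ (Fin n → ℝ)) : Prop :=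
  ∀ᶠ x in 𝓝 (0 : Fin n → ℝ), V x ∈ D x

/-- `D` is, near the origin, a smooth involutive distribution of constant dimension `r`. -/
structure IsInvolutiveDistribution {n : ℕ} (r : ℕ)
    (D : (Fin n → ℝ) → Submodule ℝ (Fin n → ℝ)) : Prop where
  frame : ∃ V : Fin r → (Fin n → ℝ) → (Fin n → ℝ), (∀ j, SmoothNear (V j)) ∧
    ∀ᶠ x in 𝓝 (0 : Fin n → ℝ), LinearIndependent ℝ (fun j => V j x) ∧
      D x = Submodule.span ℝ (Set.range fun j => V j x)
  involutive : ∀ V W : (Fin n → ℝ) → (Fin n → ℝ), SmoothNear V → SmoothNear W →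
    SectionNear V D → SectionNear W D → SectionNear (VectorField.lieBracket ℝ V W) D

/-- With `Γ i` in the role of the classical `G^{i+1}` (`1 ≤ i ≤ n - 1`), this is
`D̂^l = span {ad_{G^{l+1}} F, …, ad_{G^n} F, G}`, i.e. `D̂^n = span {G}` and
`D̂^l = span {ad_{G^{l+1}} F, D̂^{l+1}}`. -/
def hatD {m : ℕ} (F G : (Fin (m + 1) → ℝ) → (Fin (m + 1) → ℝ))
    (Γ : Fin m → (Fin (m + 1) → ℝ) → (Fin (m + 1) → ℝ)) (l : Fin (m + 1))
    (x : Fin (m + 1) → ℝ) : Submodule ℝ (Fin (m + 1) → ℝ) :=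
  Submodule.span ℝ
    ({G x} ∪ {v | ∃ j : Fin m, l ≤ j.castSucc ∧ v = VectorField.lieBracket ℝ (Γ j) F x})

/-- `D` is the flag of distributions attached to the system. The classical `D^l`
(`1 ≤ l ≤ n + 1`) is `D (l - 1)`. -/
structure IsSystemFlag {m : ℕ} (F G : (Fin (m + 1) → ℝ) → (Fin (m + 1) → ℝ))
    (D : Fin (m + 2) → (Fin (m + 1) → ℝ) → Submodule ℝ (Fin (m + 1) → ℝ)) : Prop where
  involutive : ∀ l : Fin (m + 2), IsInvolutiveDistribution (m + 1 - (l : ℕ)) (D l)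
  bot : ∀ᶠ x in 𝓝 (0 : Fin (m + 1) → ℝ), D (Fin.last (m + 1)) x = ⊥
  input : ∀ᶠ x in 𝓝 (0 : Fin (m + 1) → ℝ),
    D (Fin.last m).castSucc x = Submodule.span ℝ {G x}
  step : ∃ Γ : Fin m → (Fin (m + 1) → ℝ) → (Fin (m + 1) → ℝ),
    ∀ i : Fin m, SmoothNear (Γ i) ∧
      SectionNear (Γ i) (D i.succ.castSucc) ∧ ¬ SectionNear (Γ i) (D i.succ.succ) ∧
      ∃ O : Set (Fin (m + 1) → ℝ), IsOpen O ∧ closure O ∈ 𝓝 (0 : Fin (m + 1) → ℝ) ∧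
        ∀ x ∈ O, D i.castSucc.castSucc x = hatD F G Γ i.castSucc x

/-- `D` is the flag of the system, `X^l ∈ D^l` with `X^l(0) ∉ D^{l+1}(0)`,
`D^k = span {Y^k, …, Y^n}`, and `[X^l, Y^k] ∈ D^l` for all `l > k`. -/
structure IsAdapted {m : ℕ} (F G : (Fin (m + 1) → ℝ) → (Fin (m + 1) → ℝ))
    (D : Fin (m + 2) → (Fin (m + 1) → ℝ) → Submodule ℝ (Fin (m + 1) → ℝ))
    (X Y : Fin (m + 1) → (Fin (m + 1) → ℝ) → (Fin (m + 1) → ℝ)) : Prop where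
  flag : IsSystemFlag F G D
  smooth_X : ∀ l, SmoothNear (X l)
  X_mem : ∀ l, SectionNear (X l) (D l.castSucc)
  X_notMem : ∀ l, X l 0 ∉ D l.succ 0
  smooth_Y : ∀ k, SmoothNear (Y k)
  span_Y : ∀ k : Fin (m + 1), ∀ᶠ x in 𝓝 (0 : Fin (m + 1) → ℝ),
    D k.castSucc x = Submodule.span ℝ {v | ∃ j, k ≤ j ∧ v = Y j x}
  bracket : ∀ l k : Fin (m + 1), k < l →
    SectionNear (VectorField.lieBracket ℝ (X l) (Y k)) (D l.castSucc)

/-- The iterated Lie bracket `ad_Y^α F = ad_{Y^1}^{α_1} ⋯ ad_{Y^n}^{α_n} F`. -/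
def adPow {n : ℕ} (Y : Fin n → (Fin n → ℝ) → (Fin n → ℝ)) (α : Fin n → ℕ)
    (F : (Fin n → ℝ) → (Fin n → ℝ)) : (Fin n → ℝ) → (Fin n → ℝ) :=
  (List.finRange n).foldr (fun k Z => (VectorField.lieBracket ℝ (Y k))^[α k] Z) F

/-- For all `i < n`: `ad_Y^{α^i} F(0) ∉ D^{i+1}(0)`, while `ad_Y^β F(0) ∈ D^{i+1}(0)` for all
proper `(i+1)`-multi-indices `β` that are lexicographically less than `α^i`. -/
def BracketCondition {m : ℕ} (F : (Fin (m + 1) → ℝ) → (Fin (m + 1) → ℝ))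
    (D : Fin (m + 2) → (Fin (m + 1) → ℝ) → Submodule ℝ (Fin (m + 1) → ℝ))
    (Y : Fin (m + 1) → (Fin (m + 1) → ℝ) → (Fin (m + 1) → ℝ))
    (α : Fin m → Fin (m + 1) → ℕ) : Prop :=
  ∀ i : Fin m, adPow Y (α i) F 0 ∉ D i.succ.castSucc 0 ∧
    ∀ β : Fin (m + 1) → ℕ, IsProper i.succ β → LexLT β (α i) →
      adPow Y β F 0 ∈ D i.succ.castSucc 0

end LTF

end

noncomputable section

namespace LTF

/-! ### Iterated operators -/

/-! A feedback adds a multiple of $G$, and in triangular coordinates $G$ has only its last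
component, so $f_1,\dots,f_{n-1}$ are not affected: in those coordinates the system itself is
triangular with the same $f_i$, $i<n$ (`isLowerTriangular_pullback`). Flags, adapted data and
brackets are natural under pullback, so only triangular systems need to be studied.

For such a system the flag is forced to be $D^l=\mathrm{span}\{\partial_l,\dots,\partial_n\}$
(`flag_eq`). Hence $Y^k$ has no component before the $k$-th, and its $k$-th one is nonzero at $0$;
the bracket relations with $X$ make $Y^k_j$ depend on $x_1,\dots,x_j$ only
(`adapted_partialDeriv_eq_zero`). So on fields without components before the $i$-th,
$\mathrm{ad}_{Y^k}$ acts on the $i$-th component by the scalar operator $p\mapsto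
Y^kp-(\partial_iY^k_i)p$ (`leadingComponent_lieBracket`). The innermost bracket of a proper
$(i+1)$-multi-index produces such a field, with $i$-th component $Y^{i+1}_{i+1}\,\partial_{i+1}f_i$.

Since $\partial_j$ is lexicographically smaller than $\partial_k$ for $j>k$, a product of these
operators has a nonzero multiple of $\partial^\gamma$ as leading term (`iterOp_firstOrderOp`). As
long as everything lexicographically below vanishes, bracket and partial derivative vanish together,
so both have the same least multi-index (`bracketCondition_iff`). This holds for every choice of
adapted data, and the coordinate fields provide one choice; hence "for all" and "for some" agree. -/

/-- The composite `R_1^{α_1} ⋯ R_n^{α_n}` of a family of operators, applied to `p`. -/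
def iterOp {n : ℕ} {A : Type*} (R : Fin n → A → A) (α : Fin n → ℕ) (p : A) : A :=
  (List.finRange n).foldr (fun k q => (R k)^[α k] q) p

lemma mixedPartial_eq_iterOp {n : ℕ} (α : Fin n → ℕ) (p : (Fin n → ℝ) → ℝ) :
    mixedPartial α p = iterOp partialDeriv α p := rfl

lemma adPow_eq_iterOp {n : ℕ} (Y : Fin n → (Fin n → ℝ) → (Fin n → ℝ)) (α : Fin n → ℕ)
    (F : (Fin n → ℝ) → (Fin n → ℝ)) :
    adPow Y α F = iterOp (fun k => VectorField.lieBracket ℝ (Y k)) α F := rfl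

lemma iterate_rel {A B : Type*} {Rel : A → B → Prop} {S : A → A} {R : B → B}
    (h : ∀ Z p, Rel Z p → Rel (S Z) (R p)) (a : ℕ) :
    ∀ Z p, Rel Z p → Rel (S^[a] Z) (R^[a] p) := by
  induction a with
  | zero => exact fun Z p hZ => hZ
  | succ a ih => exact fun Z p hZ => ih _ _ (h _ _ hZ)

/-- Carries a relation through iterated operators: it serves for derivatives of sums, for brackets
against scalar operators and for brackets against their pullbacks. -/
lemma iterOp_rel {n : ℕ} {A B : Type*} {Rel : A → B → Prop} {S : Fin n → A → A}
    {R : Fin n → B → B} (h : ∀ k Z p, Rel Z p → Rel (S k Z) (R k p)) (α : Fin n → ℕ)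
    {Z : A} {p : B} (hZ : Rel Z p) : Rel (iterOp S α Z) (iterOp R α p) := by
  unfold iterOp
  induction List.finRange n with
  | nil => exact hZ
  | cons a L ih => exact iterate_rel (h a) (α a) _ _ ih

lemma foldr_eq_self {ι A : Type*} (R : ι → A → A) (α : ι → ℕ) (p : A) (L : List ι)
    (h : ∀ k ∈ L, α k = 0) : L.foldr (fun k q => (R k)^[α k] q) p = p := by
  induction L with
  | nil => rfl
  | cons a L ih =>
    rw [List.foldr_cons, ih fun k hk => h k (List.mem_cons_of_mem _ hk), h a List.mem_cons_self]
    rfl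

lemma iterOp_zero {n : ℕ} {A : Type*} (R : Fin n → A → A) (p : A) : iterOp R 0 p = p :=
  foldr_eq_self R 0 p _ fun _ _ => rfl

/-- No entry of `α` lies beyond `k`, so the added factor is the innermost one and nothing has to
commute. -/
lemma iterOp_add_single {n : ℕ} {A : Type*} (R : Fin n → A → A) (α : Fin n → ℕ) (k : Fin n)
    (hα : ∀ l, k < l → α l = 0) (p : A) :
    iterOp R (α + Pi.single k 1) p = iterOp R α (R k p) := by
  have key : ∀ L : List (Fin n), L.Pairwise (· < ·) → k ∈ L →
      L.foldr (fun l q => (R l)^[(α + Pi.single k 1 : Fin n → ℕ) l] q) p =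
        L.foldr (fun l q => (R l)^[α l] q) (R k p) := by
    intro L hL hk
    induction L with
    | nil => simp at hk
    | cons a L ih =>
      obtain ⟨ha, hL'⟩ := List.pairwise_cons.1 hL
      simp only [List.foldr_cons]
      by_cases hak : a = k
      · subst hak
        rw [foldr_eq_self, foldr_eq_self]
        · simp [Function.iterate_succ_apply]
        · exact fun l hl => hα l (ha l hl)
        · intro l hl
          simp [hα l (ha l hl), (ha l hl).ne']
      · have hkL : k ∈ L := (List.mem_cons.1 hk).resolve_left (Ne.symm hak)
        rw [ih hL' hkL]
        simp [hak]
  exact key _ (List.pairwise_lt_finRange n) (List.mem_finRange k)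

lemma exists_last_ne_zero {n : ℕ} {α : Fin n → ℕ} (h : α ≠ 0) :
    ∃ (k : Fin n) (β : Fin n → ℕ), α = β + Pi.single k 1 ∧ ∀ l, k < l → β l = 0 := by
  obtain ⟨l, hl⟩ := Function.ne_iff.1 h
  have hs : (Finset.univ.filter fun l => α l ≠ 0).Nonempty := ⟨l, by simpa using hl⟩
  have hmax := Finset.max'_mem _ hs
  set k := (Finset.univ.filter fun l => α l ≠ 0).max' hs
  have hk : α k ≠ 0 := by simpa using hmax
  refine ⟨k, α - Pi.single k 1, ?_, fun l hl => ?_⟩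
  · ext l
    by_cases hlk : l = k
    · subst hlk
      simp
      omega
    · simp [hlk]
  · have : α l = 0 := by
      by_contra hne
      exact absurd (Finset.le_max' _ l (by simpa using hne)) (not_le.2 hl)
    simp [this]

/-- Induction on multi-indices that removes one unit from the last nonzero entry. -/
lemma multiindex_induction {n : ℕ} {P : (Fin n → ℕ) → Prop} (zero : P 0)
    (step : ∀ (β : Fin n → ℕ) (k : Fin n), (∀ l, k < l → β l = 0) → P β → P (β + Pi.single k 1))
    (α : Fin n → ℕ) : P α := by
  induction hs : ∑ l, α l generalizing α with
  | zero =>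
    have : α = 0 := by
      ext l
      exact (Finset.sum_eq_zero_iff.1 hs) l (Finset.mem_univ l)
    exact this ▸ zero
  | succ s ih =>
    have hne : α ≠ 0 := by
      rintro rfl
      simp at hs
    obtain ⟨k, β, rfl, hβ⟩ := exists_last_ne_zero hne
    refine step β k hβ (ih β ?_)
    simp [Finset.sum_add_distrib] at hs
    omega

/-! ### Germs of smooth functions -/

section Smooth

variable {A B C : Type*} [NormedAddCommGroup A] [NormedSpace ℝ A]
  [NormedAddCommGroup B] [NormedSpace ℝ B] [NormedAddCommGroup C] [NormedSpace ℝ C]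

lemma SmoothNear.differentiableAt {h : A → B} (hh : SmoothNear h) :
    ∀ᶠ x in 𝓝 (0 : A), DifferentiableAt ℝ h x :=
  hh.mono fun _ hx => hx.differentiableAt (by simp)

lemma smoothNear_const (c : B) : SmoothNear fun _ : A => c :=
  Eventually.of_forall fun _ => contDiffAt_const

lemma SmoothNear.fderiv {h : A → B} (hh : SmoothNear h) : SmoothNear (fderiv ℝ h) :=
  hh.mono fun _ hx => hx.fderiv_right (m := ∞) (by simp)

lemma SmoothNear.clm_apply {h : A → B →L[ℝ] C} {k : A → B} (hh : SmoothNear h)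
    (hk : SmoothNear k) : SmoothNear fun x => h x (k x) := by
  filter_upwards [hh, hk] with x hx kx
  exact hx.clm_apply kx

lemma SmoothNear.sub {h k : A → B} (hh : SmoothNear h) (hk : SmoothNear k) :
    SmoothNear (h - k) := by
  filter_upwards [hh, hk] with x hx kx
  exact hx.sub kx

lemma SmoothNear.mul {h k : A → ℝ} (hh : SmoothNear h) (hk : SmoothNear k) :
    SmoothNear (h * k) := by
  filter_upwards [hh, hk] with x hx kx
  exact hx.mul kx

lemma SmoothNear.sum {ι : Type*} {s : Finset ι} {h : ι → A → B} (hh : ∀ j ∈ s, SmoothNear (h j)) :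
    SmoothNear (∑ j ∈ s, h j) := by
  have := (Finset.eventually_all s).2 hh
  filter_upwards [this] with x hx
  have e : (∑ j ∈ s, h j) = fun y => ∑ j ∈ s, h j y := by
    ext y
    simp
  rw [e]
  exact ContDiffAt.sum hx

lemma SmoothNear.lieBracket {V W : A → A} (hV : SmoothNear V) (hW : SmoothNear W) :
    SmoothNear (VectorField.lieBracket ℝ V W) :=
  (hW.fderiv.clm_apply hV).sub (hV.fderiv.clm_apply hW)

end Smooth

lemma two_le_infty : (2 : WithTop ℕ∞) ≤ ∞ := by
  exact WithTop.coe_le_coe.2 (le_top : (2 : ℕ∞) ≤ ⊤)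

lemma single_one_pos {n : ℕ} (k : Fin n) : (0 : Fin n → ℕ) < Pi.single k 1 :=
  Pi.lt_def.2 ⟨Pi.single_nonneg.2 zero_le_one, k, by simp⟩

/-! ### Partial derivatives of germs -/

section Germs

variable {n : ℕ}

lemma SmoothNear.comp_apply {V : (Fin n → ℝ) → (Fin n → ℝ)} (hV : SmoothNear V) (i : Fin n) :
    SmoothNear fun x => V x i := by
  filter_upwards [hV] with x hx
  exact (contDiffAt_pi.1 hx) i

lemma fderiv_eq_sum_partialDeriv (p : (Fin n → ℝ) → ℝ) (x v : Fin n → ℝ) :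
    fderiv ℝ p x v = ∑ j, v j * partialDeriv j p x := by
  conv_lhs => rw [← Finset.univ_sum_single v]
  rw [map_sum]
  refine Finset.sum_congr rfl fun j _ => ?_
  have : (Pi.single j (v j) : Fin n → ℝ) = v j • Pi.single j 1 := by
    rw [← Pi.single_smul]
    simp
  rw [this, map_smul]
  rfl

lemma SmoothNear.partialDeriv {p : (Fin n → ℝ) → ℝ} (hp : SmoothNear p) (k : Fin n) :
    SmoothNear (partialDeriv k p) :=
  hp.fderiv.clm_apply (smoothNear_const _)

lemma partialDeriv_congr {p q : (Fin n → ℝ) → ℝ} (h : p =ᶠ[𝓝 0] q) (k : Fin n) :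
    partialDeriv k p =ᶠ[𝓝 0] partialDeriv k q := by
  filter_upwards [h.eventuallyEq_nhds] with x hx
  simp only [partialDeriv, hx.fderiv_eq]

lemma partialDeriv_add {p q : (Fin n → ℝ) → ℝ} (hp : SmoothNear p) (hq : SmoothNear q)
    (k : Fin n) : partialDeriv k (p + q) =ᶠ[𝓝 0] partialDeriv k p + partialDeriv k q := by
  filter_upwards [hp.differentiableAt, hq.differentiableAt] with x hx hx'
  simp [partialDeriv, fderiv_add hx hx']

lemma partialDeriv_mul {p q : (Fin n → ℝ) → ℝ} (hp : SmoothNear p) (hq : SmoothNear q)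
    (k : Fin n) :
    partialDeriv k (p * q) =ᶠ[𝓝 0] partialDeriv k p * q + p * partialDeriv k q := by
  filter_upwards [hp.differentiableAt, hq.differentiableAt] with x hx hx'
  simp [partialDeriv, fderiv_mul hx hx']
  ring

lemma partialDeriv_comm {p : (Fin n → ℝ) → ℝ} (hp : SmoothNear p) (j k : Fin n) :
    partialDeriv j (partialDeriv k p) =ᶠ[𝓝 0] partialDeriv k (partialDeriv j p) := by
  filter_upwards [hp, hp.fderiv.differentiableAt] with x hx hx'
  have hs : IsSymmSndFDerivAt ℝ p x := hx.isSymmSndFDerivAt (by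
    rw [minSmoothness_of_isRCLikeNormedField]
    exact two_le_infty)
  have e : ∀ j k : Fin n, partialDeriv j (partialDeriv k p) x =
      fderiv ℝ (fderiv ℝ p) x (Pi.single j 1) (Pi.single k 1) := by
    intro j k
    unfold partialDeriv
    rw [fderiv_clm_apply hx' (differentiableAt_const _)]
    simp
  rw [e, e]
  exact hs _ _

lemma mixedPartial_congr {p q : (Fin n → ℝ) → ℝ} (h : p =ᶠ[𝓝 0] q) (α : Fin n → ℕ) :
    mixedPartial α p =ᶠ[𝓝 0] mixedPartial α q :=
  iterOp_rel (Rel := fun p q => p =ᶠ[𝓝 0] q) (fun k _ _ h => partialDeriv_congr h k) α h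

lemma mixedPartial_zero_fun {p : (Fin n → ℝ) → ℝ} (h : p =ᶠ[𝓝 0] 0) (α : Fin n → ℕ) :
    mixedPartial α p =ᶠ[𝓝 0] 0 :=
  iterOp_rel (Rel := fun p (_ : Unit) => p =ᶠ[𝓝 0] 0) (R := fun _ u => u)
    (fun k _ _ h => (partialDeriv_congr h k).trans (Eventually.of_forall fun x => by
      simp [partialDeriv])) α (p := ()) h

lemma mixedPartial_add {p q : (Fin n → ℝ) → ℝ} (hp : SmoothNear p) (hq : SmoothNear q)
    (α : Fin n → ℕ) :
    mixedPartial α (p + q) =ᶠ[𝓝 0] mixedPartial α p + mixedPartial α q := by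
  -- Three functions are compared, so two of them travel as a pair; `e` and `e'` identify the
  -- entries of the iterated pair.
  have := iterOp_rel
    (Rel := fun (r : ((Fin n → ℝ) → ℝ) × ((Fin n → ℝ) → ℝ)) s =>
      SmoothNear r.1 ∧ SmoothNear r.2 ∧ s =ᶠ[𝓝 0] r.1 + r.2)
    (S := fun k r => (partialDeriv k r.1, partialDeriv k r.2)) (R := partialDeriv)
    (fun j r s h => ⟨h.1.partialDeriv j, h.2.1.partialDeriv j,
      (partialDeriv_congr h.2.2 j).trans (partialDeriv_add h.1 h.2.1 j)⟩) α
    (Z := (p, q)) (p := p + q) ⟨hp, hq, EventuallyEq.rfl⟩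
  have e := iterOp_rel
    (Rel := fun (r : ((Fin n → ℝ) → ℝ) × ((Fin n → ℝ) → ℝ)) s => r.1 = s)
    (S := fun k r => (partialDeriv k r.1, partialDeriv k r.2)) (R := partialDeriv)
    (fun j r s h => by simp [h]) α (Z := (p, q)) (p := p) rfl
  have e' := iterOp_rel
    (Rel := fun (r : ((Fin n → ℝ) → ℝ) × ((Fin n → ℝ) → ℝ)) s => r.2 = s)
    (S := fun k r => (partialDeriv k r.1, partialDeriv k r.2)) (R := partialDeriv)
    (fun j r s h => by simp [h]) α (Z := (p, q)) (p := q) rfl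
  rw [e, e'] at this
  exact this.2.2

lemma mixedPartial_sum {ι : Type*} (s : Finset ι) {p : ι → (Fin n → ℝ) → ℝ}
    (hp : ∀ j, SmoothNear (p j)) (α : Fin n → ℕ) :
    mixedPartial α (∑ j ∈ s, p j) =ᶠ[𝓝 0] ∑ j ∈ s, mixedPartial α (p j) := by
  classical
  induction s using Finset.induction_on with
  | empty => simpa using mixedPartial_zero_fun EventuallyEq.rfl α
  | insert a s ha ih =>
    rw [Finset.sum_insert ha, Finset.sum_insert ha]
    exact (mixedPartial_add (hp a) (SmoothNear.sum fun j _ => hp j) α).trans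
      (EventuallyEq.rfl.add ih)

/-- In contrast to `iterOp_add_single`, `k` is arbitrary: symmetry of second derivatives carries
$\partial_k$ past the later ones. -/
lemma mixedPartial_add_single {p : (Fin n → ℝ) → ℝ} (hp : SmoothNear p) (α : Fin n → ℕ)
    (k : Fin n) :
    mixedPartial (α + Pi.single k 1) p =ᶠ[𝓝 0] mixedPartial α (partialDeriv k p) := by
  induction α using multiindex_induction generalizing p k with
  | zero =>
    rw [mixedPartial_eq_iterOp, iterOp_add_single _ (0 : Fin n → ℕ) _ fun _ _ => rfl]
    rfl
  | step β j hβ ih =>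
    by_cases hkj : k < j
    · have e : mixedPartial (β + Pi.single j 1 + Pi.single k 1) p =
          mixedPartial (β + Pi.single k 1) (partialDeriv j p) := by
        rw [add_right_comm, mixedPartial_eq_iterOp, iterOp_add_single]
        · rfl
        · intro l hl
          simp [hβ l hl, (hkj.trans hl).ne']
      rw [e]
      refine (ih (hp.partialDeriv j) k).trans (EventuallyEq.trans ?_ (ih (hp.partialDeriv k) j).symm)
      exact mixedPartial_congr (partialDeriv_comm hp k j) β
    · rw [mixedPartial_eq_iterOp, iterOp_add_single]
      · rfl
      · intro l hl
        have hjl : j < l := (not_lt.1 hkj).trans_lt hl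
        simp [hβ l hjl, hjl.ne']

/-- The top term of the Leibniz rule, when all lower derivatives of the second factor vanish. -/
lemma mixedPartial_mul_zero {h p : (Fin n → ℝ) → ℝ} (hh : SmoothNear h) (hp : SmoothNear p)
    (β : Fin n → ℕ) (hlow : ∀ γ < β, mixedPartial γ p 0 = 0) :
    mixedPartial β (h * p) 0 = h 0 * mixedPartial β p 0 := by
  induction β using multiindex_induction generalizing h p with
  | zero => simp only [mixedPartial_eq_iterOp, iterOp_zero, Pi.mul_apply]
  | step β k hβ ih =>
    -- Of the two terms of $\partial_k(hp)$, the one with $\partial_kh$ contributes a multiple of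
    -- $\partial^\beta p(0)$, which is among the vanishing derivatives.
    have hlt : β < β + Pi.single k 1 := lt_add_of_pos_right β (single_one_pos k)
    rw [(mixedPartial_add_single (hh.mul hp) β k).self_of_nhds,
      (mixedPartial_congr (partialDeriv_mul hh hp k) β).self_of_nhds,
      (mixedPartial_add ((hh.partialDeriv k).mul hp) (hh.mul (hp.partialDeriv k)) β).self_of_nhds,
      Pi.add_apply, ih (hh.partialDeriv k) hp fun γ hγ => hlow γ (hγ.trans hlt),
      ih hh (hp.partialDeriv k), hlow β hlt, (mixedPartial_add_single hp β k).self_of_nhds]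
    · simp
    · intro γ hγ
      rw [← (mixedPartial_add_single hp γ k).self_of_nhds]
      exact hlow _ (add_lt_add_left hγ _)

/-! ### The lexicographical order -/

lemma lexLT_iff (α β : Fin n → ℕ) : LexLT α β ↔ toLex α < toLex β :=
  ⟨fun ⟨i, h, e⟩ => ⟨i, e, h⟩, fun ⟨i, e, h⟩ => ⟨i, h, e⟩⟩

/-- This is why the $k$-th component dominates in a field that has no earlier ones. -/
lemma toLex_single_lt {j k : Fin n} (h : k < j) :
    toLex (Pi.single j 1 : Fin n → ℕ) < toLex (Pi.single k 1 : Fin n → ℕ) := by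
  rw [← lexLT_iff]
  refine ⟨k, by simp [h.ne], fun l hl => by simp [hl.ne, (hl.trans h).ne]⟩

/-! ### Leading terms of first-order operators -/

/-- The first-order operator `p ↦ a p - c p` of a vector field `a` and a function `c`. -/
def firstOrderOp (a : (Fin n → ℝ) → (Fin n → ℝ)) (c p : (Fin n → ℝ) → ℝ) : (Fin n → ℝ) → ℝ :=
  fun x => fderiv ℝ p x (a x) - c x * p x

lemma SmoothNear.firstOrderOp {a : (Fin n → ℝ) → (Fin n → ℝ)} {c p : (Fin n → ℝ) → ℝ}
    (ha : SmoothNear a) (hc : SmoothNear c) (hp : SmoothNear p) :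
    SmoothNear (firstOrderOp a c p) :=
  (hp.fderiv.clm_apply ha).sub (hc.mul hp)

/-- The operator is $\sum_j a_j\partial_j-c$. Coefficients with $j<k$ vanish; for $j>k$ the index
$\delta+e_j$ precedes $\delta+e_k$, and so does $\delta$. Only $a_k\partial_k$ survives, and its
lower Leibniz terms vanish for the same reason. -/
lemma mixedPartial_firstOrderOp {a : (Fin n → ℝ) → (Fin n → ℝ)} {c p : (Fin n → ℝ) → ℝ}
    (ha : SmoothNear a) (hc : SmoothNear c) (hp : SmoothNear p) {k : Fin n}
    (hak : ∀ j < k, ∀ᶠ x in 𝓝 0, a x j = 0) {γ : Fin n → ℕ}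
    (hlow : ∀ δ, LexLT δ (γ + Pi.single k 1) → mixedPartial δ p 0 = 0) {δ : Fin n → ℕ}
    (hδ : toLex δ ≤ toLex γ) :
    mixedPartial δ (firstOrderOp a c p) 0 = a 0 k * mixedPartial (δ + Pi.single k 1) p 0 := by
  simp only [lexLT_iff, toLex_add] at hlow
  have hpos : (0 : Lex (Fin n → ℕ)) < toLex (Pi.single k 1) :=
    Pi.toLex_strictMono (single_one_pos k)
  have e : firstOrderOp a c p =
      (∑ j, (fun x => a x j) * partialDeriv j p) + (fun x => - c x) * p := by
    ext x
    simp [firstOrderOp, fderiv_eq_sum_partialDeriv, sub_eq_add_neg]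
  have hs : ∀ j, SmoothNear ((fun x => a x j) * partialDeriv j p) := fun j =>
    (ha.comp_apply j).mul (hp.partialDeriv j)
  have hc' : SmoothNear fun x => - c x := hc.mono fun x hx => hx.neg
  rw [e, (mixedPartial_add (SmoothNear.sum fun j _ => hs j) (hc'.mul hp) δ).self_of_nhds,
    Pi.add_apply, (mixedPartial_sum _ hs δ).self_of_nhds, Finset.sum_apply,
    mixedPartial_mul_zero hc' hp, hlow δ (hδ.trans_lt (lt_add_of_pos_right _ hpos)),
    mul_zero, add_zero, Finset.sum_eq_single k]
  · rw [mixedPartial_mul_zero (ha.comp_apply k) (hp.partialDeriv k),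
      (mixedPartial_add_single hp δ k).self_of_nhds]
    intro ε hε
    rw [← (mixedPartial_add_single hp ε k).self_of_nhds]
    exact hlow _ (add_lt_add_left ((Pi.toLex_strictMono hε).trans_le hδ) _)
  · intro j _ hjk
    rcases lt_or_gt_of_ne hjk with hj | hj
    · refine (mixedPartial_zero_fun ?_ δ).self_of_nhds
      filter_upwards [hak j hj] with x hx
      simp [hx]
    · have low : ∀ ε ≤ δ, mixedPartial ε (partialDeriv j p) 0 = 0 := by
        intro ε hε
        rw [← (mixedPartial_add_single hp ε j).self_of_nhds]
        exact hlow _ (add_lt_add_of_le_of_lt ((Pi.toLex_monotone hε).trans hδ) (toLex_single_lt hj))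
      rw [mixedPartial_mul_zero (ha.comp_apply j) (hp.partialDeriv j), low δ le_rfl, mul_zero]
      exact fun ε hε => low ε hε.le
  · simp
  · intro ε hε
    exact hlow _ (((Pi.toLex_strictMono hε).trans_le hδ).trans (lt_add_of_pos_right _ hpos))

/-- A product of triangular first-order operators has `∂^γ` as its leading term. -/
lemma iterOp_firstOrderOp {a : Fin n → (Fin n → ℝ) → (Fin n → ℝ)} {c : Fin n → (Fin n → ℝ) → ℝ}
    (ha : ∀ k, SmoothNear (a k)) (hc : ∀ k, SmoothNear (c k))
    (htri : ∀ k, ∀ j < k, ∀ᶠ x in 𝓝 0, a k x j = 0) (hne : ∀ k, a k 0 k ≠ 0)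
    {p : (Fin n → ℝ) → ℝ} (hp : SmoothNear p) (γ : Fin n → ℕ)
    (hlow : ∀ δ, LexLT δ γ → mixedPartial δ p 0 = 0) :
    ∃ t : ℝ, t ≠ 0 ∧
      iterOp (fun k => firstOrderOp (a k) (c k)) γ p 0 = t * mixedPartial γ p 0 := by
  induction γ using multiindex_induction generalizing p with
  | zero => exact ⟨1, one_ne_zero, by simp only [mixedPartial_eq_iterOp, iterOp_zero, one_mul]⟩
  | step γ k hγ ih =>
    have key := fun δ => mixedPartial_firstOrderOp (ha k) (hc k) hp (htri k) hlow (δ := δ)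
    -- By `key`, the derivatives below `γ` of the new function vanish too, so the induction
    -- hypothesis applies to it.
    obtain ⟨t, ht, e⟩ := ih ((ha k).firstOrderOp (hc k) hp) (by
      intro δ hδ
      rw [lexLT_iff] at hδ
      rw [key δ hδ.le, hlow, mul_zero]
      rw [lexLT_iff]
      exact add_lt_add_left hδ _)
    refine ⟨t * a k 0 k, mul_ne_zero ht (hne k), ?_⟩
    rw [iterOp_add_single _ _ _ hγ, e, key γ le_rfl, mul_assoc]

end Germs

section Standard

variable {n m : ℕ}

/-! ### The standard flag -/

/-- The subspace of the vectors whose entries before position `l` vanish. -/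
def tailSpace (n l : ℕ) : Submodule ℝ (Fin n → ℝ) where
  carrier := {v | ∀ j : Fin n, (j : ℕ) < l → v j = 0}
  add_mem' := fun hv hw j hj => by simp [hv j hj, hw j hj]
  zero_mem' := fun _ _ => rfl
  smul_mem' := fun c v hv j hj => by simp [hv j hj]

lemma single_mem_tailSpace {l : ℕ} {k : Fin n} (h : l ≤ k) (c : ℝ) :
    Pi.single k c ∈ tailSpace n l := fun j hj => by
  have : j ≠ k := by
    rintro rfl
    omega
  simp [this]

lemma tailSpace_le_of_single_mem {l : ℕ} {H : Submodule ℝ (Fin n → ℝ)}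
    (h : ∀ k : Fin n, l ≤ k → (Pi.single k 1 : Fin n → ℝ) ∈ H) : tailSpace n l ≤ H := by
  intro v hv
  rw [← Finset.univ_sum_single v]
  refine Submodule.sum_mem _ fun k _ => ?_
  by_cases hk : l ≤ k
  · have : (Pi.single k (v k) : Fin n → ℝ) = v k • Pi.single k 1 := by
      rw [← Pi.single_smul]
      simp
    rw [this]
    exact H.smul_mem _ (h k hk)
  · rw [hv k (not_le.1 hk), Pi.single_zero]
    exact H.zero_mem

/-- A subspace that contains vectors with leading entries at all positions from `l` on contains
the `l`th tail space. -/
lemma tailSpace_le {l : ℕ} {H : Submodule ℝ (Fin n → ℝ)}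
    (h : ∀ k : Fin n, l ≤ k → ∃ w ∈ H, (∀ s < k, w s = 0) ∧ w k ≠ 0) : tailSpace n l ≤ H := by
  refine tailSpace_le_of_single_mem fun k => ?_
  -- Downward induction on `k`: the part of `w` after position `k` is already in `H`, and removing
  -- it leaves a multiple of the coordinate vector.
  induction hd : n - (k : ℕ) using Nat.strong_induction_on generalizing k with
  | _ d ih =>
    intro hk
    obtain ⟨w, hw, hlow, hne⟩ := h k hk
    have hz : w - Pi.single k (w k) ∈ tailSpace n (k + 1) := by
      intro j hj
      rcases (Nat.lt_succ_iff.1 hj).lt_or_eq with hj | hj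
      · have : j < k := hj
        simp [hlow j this, this.ne]
      · have : j = k := Fin.ext hj
        simp [this]
    have hle : tailSpace n (k + 1) ≤ H := tailSpace_le_of_single_mem fun s hs =>
      ih (n - s) (by omega) s rfl (by omega)
    have hs : (Pi.single k 1 : Fin n → ℝ) = (w k)⁻¹ • (w - (w - Pi.single k (w k))) := by
      rw [sub_sub_cancel, ← Pi.single_smul]
      simp [hne]
    rw [hs]
    exact H.smul_mem _ (H.sub_mem hw (hle hz))

/-- The coordinate vectors that span the `l`th tail space. -/
def tailFrame (n l : ℕ) (j : Fin (n - l)) : Fin n → ℝ :=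
  Pi.single ⟨l + j, by omega⟩ 1

lemma linearIndependent_tailFrame (n l : ℕ) : LinearIndependent ℝ (tailFrame n l) := by
  have := (Pi.basisFun ℝ (Fin n)).linearIndependent.comp
    (fun j : Fin (n - l) => (⟨l + j, by omega⟩ : Fin n)) (fun a b hab => by
      simp only [Fin.mk.injEq] at hab
      exact Fin.ext (by omega))
  convert this using 1
  ext j : 1
  simp [tailFrame]

lemma tailSpace_eq_span (n l : ℕ) :
    tailSpace n l = Submodule.span ℝ (Set.range (tailFrame n l)) := by
  refine le_antisymm (tailSpace_le_of_single_mem fun k hk => ?_) (Submodule.span_le.2 ?_)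
  · refine Submodule.subset_span ⟨⟨k - l, by omega⟩, ?_⟩
    simp only [tailFrame]
    congr
    omega
  · rintro _ ⟨j, rfl⟩
    exact single_mem_tailSpace (by simp) 1

lemma finrank_tailSpace (n l : ℕ) : Module.finrank ℝ (tailSpace n l) = n - l := by
  rw [tailSpace_eq_span, finrank_span_eq_card (linearIndependent_tailFrame n l), Fintype.card_fin]

lemma lieBracket_apply {V W : (Fin n → ℝ) → (Fin n → ℝ)} (hV : SmoothNear V)
    (hW : SmoothNear W) : ∀ᶠ x in 𝓝 (0 : Fin n → ℝ), ∀ j, VectorField.lieBracket ℝ V W x j =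
      fderiv ℝ (fun y => W y j) x (V x) - fderiv ℝ (fun y => V y j) x (W x) := by
  filter_upwards [hV.differentiableAt, hW.differentiableAt] with x hx hx' j
  rw [VectorField.lieBracket, Pi.sub_apply, fderiv_apply hx, fderiv_apply hx']
  rfl

lemma fderiv_eq_zero_near {p : (Fin n → ℝ) → ℝ} (h : ∀ᶠ x in 𝓝 0, p x = 0) :
    ∀ᶠ x in 𝓝 (0 : Fin n → ℝ), fderiv ℝ p x = 0 := by
  have h' : p =ᶠ[𝓝 0] fun _ => 0 := h
  filter_upwards [h'.eventuallyEq_nhds] with x hx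
  rw [hx.fderiv_eq]
  simp

lemma isInvolutiveDistribution_tailSpace (n l : ℕ) :
    IsInvolutiveDistribution (n - l) fun _ : Fin n → ℝ => tailSpace n l where
  frame := ⟨fun j _ => tailFrame n l j, fun j => smoothNear_const _, Eventually.of_forall fun _ =>
    ⟨linearIndependent_tailFrame n l, tailSpace_eq_span n l⟩⟩
  involutive := by
    intro V W hV hW sV sW
    have z : ∀ {Z : (Fin n → ℝ) → (Fin n → ℝ)}, SectionNear Z (fun _ => tailSpace n l) →
        ∀ᶠ x in 𝓝 (0 : Fin n → ℝ), ∀ j : Fin n, (j : ℕ) < l → fderiv ℝ (fun y => Z y j) x = 0 := by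
      intro Z sZ
      refine eventually_all.2 fun j => ?_
      by_cases hj : (j : ℕ) < l
      · exact (fderiv_eq_zero_near (sZ.mono fun x hx => hx j hj)).mono fun x hx _ => hx
      · exact Eventually.of_forall fun x h => absurd h hj
    filter_upwards [lieBracket_apply hV hW, z sV, z sW] with x hx hv hw j hj
    rw [hx, hv j hj, hw j hj]
    simp

/-! ### Lower triangular systems -/

lemma IsLowerTriangular.partialDeriv_eq_zero {F G : (Fin (m + 1) → ℝ) → (Fin (m + 1) → ℝ)}
    (h : IsLowerTriangular F G) (i : Fin m) {s : Fin (m + 1)} (hs : i.succ < s) :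
    ∀ᶠ x in 𝓝 0, partialDeriv s (fun y => F y i.castSucc) x = 0 := by
  obtain ⟨U, hU, hdep⟩ := h.depends i
  filter_upwards [eventually_mem_nhds_iff.2 hU, (h.smooth_f.comp_apply i.castSucc).differentiableAt]
    with x hx hd
  have hline : (fun t : ℝ => F (x + t • Pi.single s 1) i.castSucc) =ᶠ[𝓝 0]
      fun _ => F x i.castSucc := by
    have hc : Tendsto (fun t : ℝ => x + t • (Pi.single s 1 : Fin (m + 1) → ℝ)) (𝓝 0) (𝓝 x) := by
      have : Continuous fun t : ℝ => x + t • (Pi.single s 1 : Fin (m + 1) → ℝ) := by fun_prop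
      simpa using this.tendsto 0
    filter_upwards [hc hx] with t ht
    refine hdep _ ht _ (mem_of_mem_nhds hx) fun k hk => ?_
    simp [(hk.trans_lt hs).ne]
  have e : partialDeriv s (fun y => F y i.castSucc) x =
      lineDeriv ℝ (fun y => F y i.castSucc) x (Pi.single s 1) := hd.lineDeriv_eq_fderiv.symm
  rw [e, lineDeriv, hline.deriv_eq]
  simp

/-- The field `Γ` starts right after position `i`, and $F_j$ depends on coordinates up to $j+1$
only, so at most one product survives in $\Gamma(F_j)$, $j\le i$. The other half of the bracket
drops out because these components of `Γ` vanish identically. -/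
lemma IsLowerTriangular.lieBracket_apply {F G Γ : (Fin (m + 1) → ℝ) → (Fin (m + 1) → ℝ)}
    (h : IsLowerTriangular F G) (hΓ : SmoothNear Γ) (i : Fin m)
    (sΓ : SectionNear Γ fun _ => tailSpace (m + 1) (i + 1)) :
    ∀ᶠ x in 𝓝 0, (∀ j < i.castSucc, VectorField.lieBracket ℝ Γ F x j = 0) ∧
      VectorField.lieBracket ℝ Γ F x i.castSucc =
        Γ x i.succ * partialDeriv i.succ (fun y => F y i.castSucc) x := by
  have hz : ∀ j ≤ i.castSucc, ∀ᶠ x in 𝓝 0, fderiv ℝ (fun y => Γ y j) x = 0 := fun j hj =>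
    fderiv_eq_zero_near (sΓ.mono fun x hx => hx j (Nat.lt_succ_of_le hj))
  have hz' : ∀ᶠ x in 𝓝 0, ∀ j ≤ i.castSucc, fderiv ℝ (fun y => Γ y j) x = 0 :=
    eventually_all.2 fun j => by
      by_cases hj : j ≤ i.castSucc
      · exact (hz j hj).mono fun x hx _ => hx
      · exact Eventually.of_forall fun x h => absurd h hj
  have hd : ∀ᶠ x in 𝓝 0, ∀ (j : Fin m) (s : Fin (m + 1)), j.succ < s →
      partialDeriv s (fun y => F y j.castSucc) x = 0 :=
    eventually_all.2 fun j => eventually_all.2 fun s => by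
      by_cases hj : j.succ < s
      · exact (h.partialDeriv_eq_zero j hj).mono fun x hx _ => hx
      · exact Eventually.of_forall fun x h => absurd h hj
  filter_upwards [LTF.lieBracket_apply hΓ h.smooth_f, hz', hd, sΓ] with x hx hz hd hs
  constructor
  · intro j hj
    rw [hx, hz j hj.le, fderiv_eq_sum_partialDeriv]
    simp only [zero_apply, sub_zero]
    refine Finset.sum_eq_zero fun s _ => ?_
    obtain ⟨j', rfl⟩ : ∃ j' : Fin m, j = j'.castSucc :=
      ⟨⟨j, lt_trans hj i.2⟩, rfl⟩
    by_cases hsi : (s : ℕ) < i + 1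
    · rw [hs s hsi, zero_mul]
    · rw [hd j' s, mul_zero]
      have : (j' : ℕ) < i := hj
      rw [Fin.lt_def, Fin.val_succ]
      omega
  · rw [hx, hz _ le_rfl, fderiv_eq_sum_partialDeriv, Finset.sum_eq_single i.succ]
    · simp
    · intro s _ hsi
      rcases lt_or_gt_of_ne hsi with hlt | hgt
      · rw [hs s hlt, zero_mul]
      · rw [hd i s hgt, mul_zero]
    · simp

lemma IsLowerTriangular.g_near {F G : (Fin (m + 1) → ℝ) → (Fin (m + 1) → ℝ)}
    (h : IsLowerTriangular F G) : ∀ᶠ x in 𝓝 0, G x ∈ tailSpace (m + 1) m ∧ G x (Fin.last m) ≠ 0 := by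
  have hc : ContinuousAt (fun x => G x (Fin.last m)) 0 :=
    (h.smooth_g.comp_apply _).self_of_nhds.continuousAt
  filter_upwards [eventually_all.2 h.g_eq_zero, hc.eventually_ne h.g_last] with x hx hne
  exact ⟨fun j hj => hx ⟨j, hj⟩, hne⟩

lemma IsLowerTriangular.hatD_le {F G : (Fin (m + 1) → ℝ) → (Fin (m + 1) → ℝ)}
    (h : IsLowerTriangular F G) {Γ : Fin m → (Fin (m + 1) → ℝ) → (Fin (m + 1) → ℝ)} {i : Fin m}
    (hΓ : ∀ j, SmoothNear (Γ j))
    (sΓ : ∀ j, i ≤ j → SectionNear (Γ j) fun _ => tailSpace (m + 1) (j + 1)) :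
    ∀ᶠ x in 𝓝 0, hatD F G Γ i.castSucc x ≤ tailSpace (m + 1) i := by
  have hb : ∀ᶠ x in 𝓝 0, ∀ j, i ≤ j →
      ∀ s < j.castSucc, VectorField.lieBracket ℝ (Γ j) F x s = 0 :=
    eventually_all.2 fun j => by
      by_cases hj : i ≤ j
      · exact (h.lieBracket_apply (hΓ j) j (sΓ j hj)).mono fun x hx _ => hx.1
      · exact Eventually.of_forall fun x h => absurd h hj
  filter_upwards [hb, h.g_near] with x hx hg
  refine Submodule.span_le.2 (Set.union_subset ?_ ?_)
  · rintro _ rfl s hs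
    exact hg.1 s (hs.trans i.2)
  · rintro _ ⟨j, hj, rfl⟩ s hs
    have hij : i ≤ j := hj
    have hsj : (s : ℕ) < j := lt_of_lt_of_le hs (Fin.le_def.1 hij)
    exact hx j hij s hsj

lemma eventually_eq_zero_of_closure_mem_nhds {p : (Fin n → ℝ) → ℝ}
    (hp : ∀ᶠ x in 𝓝 0, ContinuousAt p x) {O : Set (Fin n → ℝ)} (hO : closure O ∈ 𝓝 0)
    (hz : ∀ᶠ x in 𝓝 0, x ∈ O → p x = 0) : ∀ᶠ x in 𝓝 0, p x = 0 := by
  filter_upwards [hp, hO, hz.eventually_nhds] with x hx hxO hxz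
  by_contra hne
  obtain ⟨y, hy, hyO⟩ := mem_closure_iff_nhds.1 hxO _ (hxz.and (hx.eventually_ne hne))
  exact hy.2 (hy.1 hyO)

/-- The flag of a lower triangular system is unique. -/
theorem IsLowerTriangular.flag_eq {F G : (Fin (m + 1) → ℝ) → (Fin (m + 1) → ℝ)}
    (h : IsLowerTriangular F G) {D : Fin (m + 2) → (Fin (m + 1) → ℝ) → Submodule ℝ (Fin (m + 1) → ℝ)}
    (hD : IsSystemFlag F G D) (l : Fin (m + 2)) : ∀ᶠ x in 𝓝 0, D l x = tailSpace (m + 1) l := by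
  obtain ⟨Γ, hΓ⟩ := hD.step
  -- Strengthened to all `l' ≥ l`, because `hatD` at `i` involves every `Γ j` with `j ≥ i`, and each
  -- must be located in its tail space.
  suffices ∀ l l' : Fin (m + 2), l ≤ l' → ∀ᶠ x in 𝓝 0, D l' x = tailSpace (m + 1) l' from
    this l l le_rfl
  intro l
  induction l using Fin.reverseInduction with
  | last =>
    intro l' hl'
    obtain rfl : l' = Fin.last (m + 1) := le_antisymm (Fin.le_last _) hl'
    filter_upwards [hD.bot] with x hx
    rw [hx, eq_comm, eq_bot_iff]
    exact fun v hv => (Submodule.mem_bot ℝ).2 (funext fun j => hv j j.2)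
  | cast l ih =>
    intro l' hl'
    rcases hl'.lt_or_eq with hlt | rfl
    · exact ih l' hlt
    -- One inclusion is enough, since the dimensions agree.
    · suffices ∀ᶠ x in 𝓝 0, D l.castSucc x ≤ tailSpace (m + 1) l by
        obtain ⟨V, -, hV⟩ := (hD.involutive l.castSucc).frame
        filter_upwards [this, hV] with x hx hVx
        refine Submodule.eq_of_le_of_finrank_eq hx ?_
        rw [finrank_tailSpace, hVx.2, finrank_span_eq_card hVx.1, Fintype.card_fin]
      induction l using Fin.lastCases with
      | last =>
        filter_upwards [hD.input, h.g_near] with x hx hg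
        rw [hx, Submodule.span_singleton_le_iff_mem]
        exact hg.1
      | cast i =>
        obtain ⟨-, -, -, O, -, hOcl, hO⟩ := hΓ i
        have hhat : ∀ᶠ x in 𝓝 0, hatD F G Γ i.castSucc x ≤ tailSpace (m + 1) i := by
          refine h.hatD_le (fun j => (hΓ j).1) fun j hj => ?_
          have hj' : i.castSucc.succ ≤ j.succ.castSucc := by
            rw [Fin.le_def]
            simpa using hj
          filter_upwards [(hΓ j).2.1, ih _ hj'] with x hx hx'
          rw [hx'] at hx
          exact hx
        -- The flag equals `hatD` on `O` only. Lying in the tail space means vanishing of components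
        -- of a continuous frame, which extends to the closure of `O`.
        obtain ⟨V, hVs, hV⟩ := (hD.involutive i.castSucc.castSucc).frame
        have key : ∀ᶠ x in 𝓝 0, ∀ r, V r x ∈ tailSpace (m + 1) i := by
          refine eventually_all.2 fun r => ?_
          have : ∀ᶠ x in 𝓝 0, ∀ j : Fin (m + 1), (j : ℕ) < i → V r x j = 0 := by
            refine eventually_all.2 fun j => ?_
            by_cases hj : (j : ℕ) < i
            · have := eventually_eq_zero_of_closure_mem_nhds (p := fun x => V r x j)
                (((hVs r).comp_apply j).mono fun x hx => hx.continuousAt) hOcl (by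
                  filter_upwards [hhat, hV] with x hx hVx hxO
                  have hm : V r x ∈ D i.castSucc.castSucc x := by
                    rw [hVx.2]
                    exact Submodule.subset_span ⟨r, rfl⟩
                  rw [hO x hxO] at hm
                  exact hx hm j hj)
              exact this.mono fun x hx _ => hx
            · exact Eventually.of_forall fun x h => absurd h hj
          exact this
        filter_upwards [key, hV] with x hx hVx
        rw [hVx.2]
        refine Submodule.span_le.2 ?_
        rintro _ ⟨r, rfl⟩
        exact hx r

/-! ### Existence of adapted data -/

/-- A finite Baire argument: shrink `V` around a point where one function is nonzero and continue
there. It yields one dense open set on which all $\partial f_i/\partial x_{i+1}$ are nonzero. -/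
lemma exists_forall_ne_zero_of_finset {ι X : Type*} [TopologicalSpace X] (p : ι → X → ℝ)
    {U : Set X} (hc : ∀ j, ∀ x ∈ U, ContinuousAt (p j) x)
    (hd : ∀ j, ∀ V ⊆ U, IsOpen V → V.Nonempty → ∃ x ∈ V, p j x ≠ 0) (s : Finset ι) :
    ∀ V ⊆ U, IsOpen V → V.Nonempty → ∃ x ∈ V, ∀ j ∈ s, p j x ≠ 0 := by
  classical
  induction s using Finset.induction_on with
  | empty => exact fun V _ _ ⟨x, hx⟩ => ⟨x, hx, by simp⟩
  | insert a s ha ih =>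
    intro V hVU hV hne
    obtain ⟨y, hyV, hy⟩ := hd a V hVU hV hne
    obtain ⟨W, hWsub, hW, hyW⟩ := eventually_nhds_iff.1
      (((hc a y (hVU hyV)).eventually_ne hy).and (hV.mem_nhds hyV))
    obtain ⟨x, hxW, hx⟩ := ih W (fun x hx => hVU (hWsub x hx).2) hW ⟨y, hyW⟩
    refine ⟨x, (hWsub x hxW).2, fun j hj => ?_⟩
    rcases Finset.mem_insert.1 hj with rfl | hj
    · exact (hWsub x hxW).1
    · exact hx j hj

theorem IsLowerTriangular.isSystemFlag {F G : (Fin (m + 1) → ℝ) → (Fin (m + 1) → ℝ)}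
    (h : IsLowerTriangular F G) : IsSystemFlag F G fun l _ => tailSpace (m + 1) l where
  involutive l := isInvolutiveDistribution_tailSpace (m + 1) l
  bot := Eventually.of_forall fun x => eq_bot_iff.2 fun v hv =>
    (Submodule.mem_bot ℝ).2 (funext fun j => hv j j.2)
  input := by
    filter_upwards [h.g_near] with x hx
    refine le_antisymm (tailSpace_le fun k hk => ?_) ?_
    · obtain rfl : k = Fin.last m := le_antisymm (Fin.le_last _) hk
      exact ⟨G x, Submodule.mem_span_singleton_self _, fun s hs => hx.1 s hs, hx.2⟩
    · rw [Submodule.span_singleton_le_iff_mem]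
      exact hx.1
  step := by
    -- With constant coordinate fields, the leading component of the bracket with `F` is exactly
    -- $\partial f_i/\partial x_{i+1}$.
    set Γ : Fin m → (Fin (m + 1) → ℝ) → (Fin (m + 1) → ℝ) := fun i _ => Pi.single i.succ 1
    have hΓ : ∀ i, SmoothNear (Γ i) := fun i => smoothNear_const _
    have sΓ : ∀ i : Fin m, SectionNear (Γ i) fun _ => tailSpace (m + 1) (i + 1) := fun i =>
      Eventually.of_forall fun x => single_mem_tailSpace (by simp) 1
    choose U hU hUd using h.nondegenerate
    set p : Fin m → (Fin (m + 1) → ℝ) → ℝ := fun i => partialDeriv i.succ fun y => F y i.castSucc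
    have hp : ∀ i, SmoothNear (p i) := fun i => (h.smooth_f.comp_apply _).partialDeriv _
    obtain ⟨W, hW, hWo, h0⟩ := eventually_nhds_iff.1
      ((eventually_all.2 hp).and <| (eventually_all.2 fun i => (hU i : ∀ᶠ x in 𝓝 0, x ∈ U i)).and <|
        (eventually_all.2 fun i => h.lieBracket_apply (hΓ i) i (sΓ i)).and <| h.g_near.and <|
        eventually_all.2 fun i => h.hatD_le (i := i) hΓ fun j _ => sΓ j)
    have hWc : ∀ j, ∀ x ∈ W, ContinuousAt (p j) x := fun j x hx => ((hW x hx).1 j).continuousAt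
    have hWd : ∀ j, ∀ V ⊆ W, IsOpen V → V.Nonempty → ∃ x ∈ V, p j x ≠ 0 := fun j V hVW =>
      hUd j V fun x hx => (hW x (hVW hx)).2.1 j
    refine ⟨Γ, fun i => ⟨hΓ i, ?_, ?_, {x | x ∈ W ∧ ∀ j, p j x ≠ 0}, ?_, ?_, ?_⟩⟩
    · simpa using sΓ i
    · intro hs
      have : (Pi.single i.succ 1 : Fin (m + 1) → ℝ) ∈ tailSpace (m + 1) (i + 2) := by
        simpa [Γ] using hs.self_of_nhds
      simpa using this i.succ (by simp)
    · rw [isOpen_iff_mem_nhds]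
      rintro x ⟨hx, hne⟩
      exact inter_mem (hWo.mem_nhds hx)
        (eventually_all.2 fun j => (hWc j x hx).eventually_ne (hne j))
    · refine mem_of_superset (hWo.mem_nhds h0) fun x hx => mem_closure_iff.2 fun V hV hxV => ?_
      obtain ⟨y, hy, hyne⟩ := exists_forall_ne_zero_of_finset p hWc hWd Finset.univ (V ∩ W)
        Set.inter_subset_right (hV.inter hWo) ⟨x, hxV, hx⟩
      exact ⟨y, hy.1, hy.2, fun j => hyne j (Finset.mem_univ j)⟩
    · rintro x ⟨hx, hne⟩
      obtain ⟨-, -, hb, hg, hle⟩ := hW x hx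
      refine le_antisymm (tailSpace_le fun k hk => ?_) (hle i)
      induction k using Fin.lastCases with
      | last => exact ⟨G x, Submodule.subset_span (Or.inl rfl), fun s hs => hg.1 s hs, hg.2⟩
      | cast j =>
        refine ⟨_, Submodule.subset_span (Or.inr ⟨j, hk, rfl⟩), (hb j).1, ?_⟩
        rw [(hb j).2]
        simpa [Γ] using hne j

theorem IsLowerTriangular.isAdapted {F G : (Fin (m + 1) → ℝ) → (Fin (m + 1) → ℝ)}
    (h : IsLowerTriangular F G) : IsAdapted F G (fun l _ => tailSpace (m + 1) l)
      (fun l _ => Pi.single l 1) (fun l _ => Pi.single l 1) where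
  flag := h.isSystemFlag
  smooth_X l := smoothNear_const _
  X_mem l := Eventually.of_forall fun x => single_mem_tailSpace le_rfl 1
  X_notMem l hl := by simpa using hl l (by simp)
  smooth_Y l := smoothNear_const _
  span_Y k := Eventually.of_forall fun x => by
    refine le_antisymm (tailSpace_le_of_single_mem fun j hj =>
      Submodule.subset_span ⟨j, hj, rfl⟩) (Submodule.span_le.2 ?_)
    rintro _ ⟨j, hj, rfl⟩
    exact single_mem_tailSpace hj 1
  bracket l k _ := Eventually.of_forall fun x => by
    simp [VectorField.lieBracket]

end Standard

section Criterion

variable {m : ℕ} {F G : (Fin (m + 1) → ℝ) → (Fin (m + 1) → ℝ)}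
  {D : Fin (m + 2) → (Fin (m + 1) → ℝ) → Submodule ℝ (Fin (m + 1) → ℝ)}
  {X Y : Fin (m + 1) → (Fin (m + 1) → ℝ) → (Fin (m + 1) → ℝ)}

/-! ### Adapted data of a lower triangular system are triangular -/

lemma IsLowerTriangular.flag_castSucc_eq (h : IsLowerTriangular F G) (hD : IsSystemFlag F G D)
    (k : Fin (m + 1)) : ∀ᶠ x in 𝓝 0, D k.castSucc x = tailSpace (m + 1) k :=
  h.flag_eq hD k.castSucc

lemma IsLowerTriangular.adapted_mem (h : IsLowerTriangular F G) (hA : IsAdapted F G D X Y)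
    (k : Fin (m + 1)) : ∀ᶠ x in 𝓝 0, Y k x ∈ tailSpace (m + 1) k := by
  filter_upwards [h.flag_castSucc_eq hA.flag k, hA.span_Y k] with x hx hy
  rw [← hx, hy]
  exact Submodule.subset_span ⟨k, le_rfl, rfl⟩

lemma IsLowerTriangular.adapted_apply_eq_zero (h : IsLowerTriangular F G)
    (hA : IsAdapted F G D X Y) (k : Fin (m + 1)) : ∀ j < k, ∀ᶠ x in 𝓝 0, Y k x j = 0 :=
  fun j hj => (h.adapted_mem hA k).mono fun _ hx => hx j hj

/-- Otherwise $Y^k(0),\dots,Y^n(0)$ would all lie in the next tail space, which is too small to be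
$D^k(0)$. -/
lemma IsLowerTriangular.adapted_apply_ne_zero (h : IsLowerTriangular F G)
    (hA : IsAdapted F G D X Y) (k : Fin (m + 1)) : Y k 0 k ≠ 0 := by
  intro h0
  have hle : tailSpace (m + 1) k ≤ tailSpace (m + 1) (k + 1) := by
    rw [← (h.flag_castSucc_eq hA.flag k).self_of_nhds, (hA.span_Y k).self_of_nhds,
      Submodule.span_le]
    rintro _ ⟨j, hj, rfl⟩ s hs
    rcases hj.lt_or_eq with hlt | rfl
    · have hsj : s < j := lt_of_le_of_lt (Nat.lt_succ_iff.1 hs) hlt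
      exact (h.adapted_mem hA j).self_of_nhds s hsj
    · rcases (Nat.lt_succ_iff.1 hs).lt_or_eq with hlt | heq
      · exact (h.adapted_mem hA k).self_of_nhds s hlt
      · rw [Fin.ext heq, h0]
  simpa using hle (single_mem_tailSpace le_rfl 1) k (Nat.lt_succ_self _)

/-- For `k < l` this is part of adaptedness; for `k ≥ l` both fields are sections of the same
involutive distribution. -/
lemma IsLowerTriangular.adapted_bracket_mem (h : IsLowerTriangular F G)
    (hA : IsAdapted F G D X Y) (l k : Fin (m + 1)) :
    ∀ᶠ x in 𝓝 0, VectorField.lieBracket ℝ (X l) (Y k) x ∈ tailSpace (m + 1) l := by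
  rcases lt_or_ge k l with hkl | hlk
  · filter_upwards [h.flag_castSucc_eq hA.flag l, hA.bracket l k hkl] with x hx hb
    rwa [← hx]
  · refine (isInvolutiveDistribution_tailSpace (m + 1) l).involutive _ _ (hA.smooth_X l)
      (hA.smooth_Y k) ?_ ?_
    · filter_upwards [h.flag_castSucc_eq hA.flag l, hA.X_mem l] with x hx hb
      rwa [← hx]
    · exact (h.adapted_mem hA k).mono fun x hx j hj => hx j (lt_of_lt_of_le hj hlk)

/-- As $X^s_i=0$, the $i$-th component of $[X^s,Y^k]\in D^s$ gives $0=\sum_{t\ge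
s}X^s_t\,\partial_tY^k_i$. Downward induction on $s$ removes the terms $t>s$, and $X^s_s\ne0$ near
$0$. -/
lemma IsLowerTriangular.adapted_partialDeriv_eq_zero (h : IsLowerTriangular F G)
    (hA : IsAdapted F G D X Y) (k i s : Fin (m + 1)) (his : i < s) :
    ∀ᶠ x in 𝓝 0, partialDeriv s (fun y => Y k y i) x = 0 := by
  induction hd : m + 1 - (s : ℕ) using Nat.strong_induction_on generalizing s with
  | _ d ih =>
    have hXm : ∀ᶠ x in 𝓝 0, X s x ∈ tailSpace (m + 1) s := by
      filter_upwards [h.flag_castSucc_eq hA.flag s, hA.X_mem s] with x hx hb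
      rwa [← hx]
    have hXne : X s 0 s ≠ 0 := by
      intro h0
      apply hA.X_notMem s
      rw [(h.flag_eq hA.flag s.succ).self_of_nhds]
      intro j hj
      have hj' : (j : ℕ) < s + 1 := hj
      rcases (Nat.lt_succ_iff.1 hj').lt_or_eq with hlt | heq
      · exact hXm.self_of_nhds j hlt
      · rw [Fin.ext heq, h0]
    have hhigh : ∀ᶠ x in 𝓝 0, ∀ t, s < t → partialDeriv t (fun y => Y k y i) x = 0 :=
      eventually_all.2 fun t => by
        by_cases hst : s < t
        · refine (ih (m + 1 - t) ?_ t (his.trans hst) rfl).mono fun x hx _ => hx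
          have := Fin.lt_def.1 hst
          omega
        · exact Eventually.of_forall fun x h => absurd h hst
    have hc : ContinuousAt (fun x => X s x s) 0 :=
      ((hA.smooth_X s).comp_apply s).self_of_nhds.continuousAt
    filter_upwards [hXm, hhigh, hc.eventually_ne hXne, h.adapted_bracket_mem hA s k,
      LTF.lieBracket_apply (hA.smooth_X s) (hA.smooth_Y k),
      fderiv_eq_zero_near (hXm.mono fun x hx => hx i his)] with x hX hY hne hb hbr hfd
    have e := hb i his
    rw [hbr, hfd, fderiv_eq_sum_partialDeriv, Finset.sum_eq_single s] at e
    · simpa [hne] using e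
    · intro t _ hts
      rcases lt_or_gt_of_ne hts with hlt | hgt
      · rw [hX t hlt, zero_mul]
      · rw [hY t hgt, mul_zero]
    · simp

/-! ### Iterated brackets as triangular operators -/

/-- The operator that `ad_{Y^k}` induces on the `i`th component, when the components before it
vanish. -/
def componentOp (Y : Fin (m + 1) → (Fin (m + 1) → ℝ) → (Fin (m + 1) → ℝ)) (i : Fin m)
    (k : Fin (m + 1)) : ((Fin (m + 1) → ℝ) → ℝ) → (Fin (m + 1) → ℝ) → ℝ :=
  firstOrderOp (Y k) (partialDeriv i.castSucc fun x => Y k x i.castSucc)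

/-- `Z` is smooth, its components before the `i`th one vanish, and the `i`th one is `p`. -/
def LeadingComponent (i : Fin m) (Z : (Fin (m + 1) → ℝ) → (Fin (m + 1) → ℝ))
    (p : (Fin (m + 1) → ℝ) → ℝ) : Prop :=
  SmoothNear Z ∧ (∀ᶠ x in 𝓝 0, ∀ j < i.castSucc, Z x j = 0) ∧
    (fun x => Z x i.castSucc) =ᶠ[𝓝 0] p

/-- In $[Y^k,Z]_j=Y^k(Z_j)-Z(Y^k_j)$ the function $Y^k_j$ depends on coordinates up to $j$ only,
while $Z$ starts at $i$: the last term is $0$ for $j<i$ and $Z_i\,\partial_iY^k_i$ for $j=i$. -/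
lemma IsLowerTriangular.leadingComponent_lieBracket (h : IsLowerTriangular F G)
    (hA : IsAdapted F G D X Y) (i : Fin m) (k : Fin (m + 1))
    (Z : (Fin (m + 1) → ℝ) → (Fin (m + 1) → ℝ)) (p : (Fin (m + 1) → ℝ) → ℝ)
    (hZ : LeadingComponent i Z p) :
    LeadingComponent i (VectorField.lieBracket ℝ (Y k) Z) (componentOp Y i k p) := by
  obtain ⟨hZs, hZ0, hZp⟩ := hZ
  have hY : ∀ᶠ x in 𝓝 0, ∀ j s : Fin (m + 1), j < s → partialDeriv s (fun y => Y k y j) x = 0 :=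
    eventually_all.2 fun j => eventually_all.2 fun s => by
      by_cases hjs : j < s
      · exact (h.adapted_partialDeriv_eq_zero hA k j s hjs).mono fun x hx _ => hx
      · exact Eventually.of_forall fun x h => absurd h hjs
  have hd : ∀ᶠ x in 𝓝 0, ∀ j < i.castSucc, fderiv ℝ (fun y => Z y j) x = 0 :=
    eventually_all.2 fun j => by
      by_cases hj : j < i.castSucc
      · exact (fderiv_eq_zero_near (hZ0.mono fun x hx => hx j hj)).mono fun x hx _ => hx
      · exact Eventually.of_forall fun x h => absurd h hj
  have hbr := LTF.lieBracket_apply (hA.smooth_Y k) hZs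
  refine ⟨(hA.smooth_Y k).lieBracket hZs, ?_, ?_⟩
  · filter_upwards [hbr, hY, hd, hZ0] with x hx hY hd hZ0 j hj
    rw [hx, hd j hj, fderiv_eq_sum_partialDeriv]
    simp only [zero_apply, zero_sub, neg_eq_zero]
    refine Finset.sum_eq_zero fun s _ => ?_
    rcases lt_or_ge s i.castSucc with hs | hs
    · rw [hZ0 s hs, zero_mul]
    · rw [hY j s (hj.trans_le hs), mul_zero]
  · filter_upwards [hbr, hY, hZ0, hZp.eventuallyEq_nhds] with x hx hY hZ0 hZp
    rw [hx, fderiv_eq_sum_partialDeriv (fun y => Y k y i.castSucc), componentOp, firstOrderOp,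
      hZp.fderiv_eq, ← hZp.eq_of_nhds, Finset.sum_eq_single i.castSucc]
    · rw [mul_comm]
    · intro s _ hs
      rcases lt_or_gt_of_ne hs with hs | hs
      · rw [hZ0 s hs, zero_mul]
      · rw [hY _ s hs, mul_zero]
    · simp

/-- The early components of `F` need not vanish; the innermost bracket, present in every proper
multi-index, is what starts the iteration. -/
lemma IsLowerTriangular.leadingComponent_first (h : IsLowerTriangular F G)
    (hA : IsAdapted F G D X Y) (i : Fin m) :
    LeadingComponent i (VectorField.lieBracket ℝ (Y i.succ) F)
      ((fun x => Y i.succ x i.succ) * partialDeriv i.succ fun y => F y i.castSucc) := by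
  have hb := h.lieBracket_apply (hA.smooth_Y i.succ) i (by
    have := h.adapted_mem hA i.succ
    rwa [Fin.val_succ] at this)
  exact ⟨(hA.smooth_Y _).lieBracket h.smooth_f, hb.mono fun x hx => hx.1,
    hb.mono fun x hx => hx.2⟩

lemma IsLowerTriangular.adPow_mem_iff (h : IsLowerTriangular F G) (hA : IsAdapted F G D X Y)
    (i : Fin m) (γ : Fin (m + 1) → ℕ) (hγ : ∀ l, i.succ < l → γ l = 0) :
    adPow Y (γ + Pi.single i.succ 1) F 0 ∈ D i.succ.castSucc 0 ↔
      iterOp (componentOp Y i) γ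
        ((fun x => Y i.succ x i.succ) * partialDeriv i.succ fun y => F y i.castSucc) 0 = 0 := by
  have hrel := iterOp_rel (h.leadingComponent_lieBracket hA i) γ (h.leadingComponent_first hA i)
  rw [adPow_eq_iterOp, iterOp_add_single _ _ _ hγ, (h.flag_castSucc_eq hA.flag _).self_of_nhds,
    ← hrel.2.2.self_of_nhds]
  refine ⟨fun hm => hm i.castSucc (by simp), fun h0 j hj => ?_⟩
  rcases (Nat.lt_succ_iff.1 (by simpa using hj)).lt_or_eq with hlt | heq
  · exact hrel.2.1.self_of_nhds j hlt
  · have : j = i.castSucc := Fin.ext heq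
    rw [this]
    exact h0

/-- Lets the lexicographic induction run over all multi-indices, including those with entries beyond
`i.succ`, for which there is no bracket condition. -/
lemma IsLowerTriangular.mixedPartial_eq_zero (h : IsLowerTriangular F G) (i : Fin m)
    {δ : Fin (m + 1) → ℕ} (hδ : ¬ ∀ l, i.succ < l → δ l = 0) :
    mixedPartial δ (partialDeriv i.succ fun y => F y i.castSucc) 0 = 0 := by
  push Not at hδ
  obtain ⟨l, hl, hne⟩ := hδ
  have hp : SmoothNear fun y => F y i.castSucc := h.smooth_f.comp_apply _
  have e : δ = (δ - Pi.single l 1) + Pi.single l 1 := by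
    ext j
    by_cases hj : j = l
    · subst hj
      simp
      omega
    · simp [hj]
  rw [e, (mixedPartial_add_single (hp.partialDeriv _) _ _).self_of_nhds]
  refine (mixedPartial_zero_fun ((partialDeriv_comm hp _ _).trans ?_) _).self_of_nhds
  refine (partialDeriv_congr (h.partialDeriv_eq_zero i hl) i.succ).trans ?_
  exact Eventually.of_forall fun x => by simp [partialDeriv]

/-- For a lower triangular system, the bracket condition of adapted data determines the least
multi-indices of the right-hand sides. -/
theorem IsLowerTriangular.bracketCondition_iff (h : IsLowerTriangular F G)
    (hA : IsAdapted F G D X Y) {α : Fin m → Fin (m + 1) → ℕ} (hα : ∀ i, IsProper i.succ (α i)) :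
    BracketCondition F D Y α ↔
      ∀ i : Fin m, IsLeastIndex i.succ (fun x => F x i.castSucc) (α i) := by
  refine forall_congr' fun i => ?_
  have split : ∀ β : Fin (m + 1) → ℕ, IsProper i.succ β →
      ∃ γ : Fin (m + 1) → ℕ, β = γ + Pi.single i.succ 1 ∧ ∀ l, i.succ < l → γ l = 0 := by
    intro β hβ
    refine ⟨β - Pi.single i.succ 1, ?_, fun l hl => by simp [hβ.2 l hl]⟩
    ext j
    by_cases hj : j = i.succ
    · subst hj
      have := hβ.1
      simp
      omega
    · simp [hj]
  have proper : ∀ γ : Fin (m + 1) → ℕ, (∀ l, i.succ < l → γ l = 0) →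
      IsProper i.succ (γ + Pi.single i.succ 1) := fun γ hγ =>
    ⟨by simp, fun l hl => by simp [hγ l hl, hl.ne']⟩
  have lex : ∀ γ δ : Fin (m + 1) → ℕ,
      LexLT (γ + Pi.single i.succ 1) (δ + Pi.single i.succ 1) ↔ LexLT γ δ := fun γ δ => by
    simp only [lexLT_iff, toLex_add, add_lt_add_iff_right]
  set p : (Fin (m + 1) → ℝ) → ℝ := fun y => F y i.castSucc
  have hp : SmoothNear p := h.smooth_f.comp_apply _
  set q := partialDeriv i.succ p
  have hq : SmoothNear q := hp.partialDeriv _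
  have hpq : ∀ γ, mixedPartial (γ + Pi.single i.succ 1) p 0 = mixedPartial γ q 0 := fun γ =>
    (mixedPartial_add_single hp γ _).self_of_nhds
  set y : (Fin (m + 1) → ℝ) → ℝ := fun x => Y i.succ x i.succ
  have hy : SmoothNear y := (hA.smooth_Y _).comp_apply _
  set B : (Fin (m + 1) → ℕ) → ℝ := fun γ => iterOp (componentOp Y i) γ (y * q) 0
  -- The bracket value is `t * y 0` times the derivative, with both factors nonzero.
  have hB : ∀ γ, (∀ δ, LexLT δ γ → mixedPartial δ q 0 = 0) → (B γ = 0 ↔ mixedPartial γ q 0 = 0) := by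
    intro γ hγ
    have hmul : ∀ δ, (toLex δ ≤ toLex γ) →
        mixedPartial δ (y * q) 0 = y 0 * mixedPartial δ q 0 := fun δ hδ =>
      mixedPartial_mul_zero hy hq δ fun ε hε =>
        hγ ε ((lexLT_iff _ _).2 ((Pi.toLex_strictMono hε).trans_le hδ))
    obtain ⟨t, ht, e⟩ := iterOp_firstOrderOp hA.smooth_Y
      (fun k => ((hA.smooth_Y k).comp_apply i.castSucc).partialDeriv i.castSucc)
      (h.adapted_apply_eq_zero hA) (h.adapted_apply_ne_zero hA) (hy.mul hq) γ
      (fun δ hδ => by rw [hmul δ ((lexLT_iff _ _).1 hδ).le, hγ δ hδ, mul_zero])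
    have e' : B γ = t * mixedPartial γ (y * q) 0 := e
    rw [e', hmul γ le_rfl]
    simp [ht, h.adapted_apply_ne_zero hA i.succ, y]
  -- A multi-index can have infinitely many lexicographic predecessors, so the vanishing is passed
  -- from brackets to derivatives by well-founded induction.
  have hBlow : ∀ γ, (∀ δ, LexLT δ γ → (∀ l, i.succ < l → δ l = 0) → B δ = 0) →
      ∀ δ, LexLT δ γ → mixedPartial δ q 0 = 0 := by
    intro γ hγ δ
    induction hδ : toLex δ using WellFoundedLT.induction generalizing δ with
    | _ a ih =>
      subst hδ
      intro hlt
      by_cases hs : ∀ l, i.succ < l → δ l = 0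
      · refine (hB δ fun ε hε => ih (toLex ε) ((lexLT_iff _ _).1 hε) ε rfl ?_).1 (hγ δ hlt hs)
        rw [lexLT_iff] at *
        exact hε.trans hlt
      · exact h.mixedPartial_eq_zero i hs
  obtain ⟨γ, hαγ, hγ⟩ := split _ (hα i)
  rw [hαγ, h.adPow_mem_iff hA i γ hγ]
  have hbr : (∀ β, IsProper i.succ β → LexLT β (γ + Pi.single i.succ 1) →
      adPow Y β F 0 ∈ D i.succ.castSucc 0) ↔
      ∀ δ, LexLT δ γ → (∀ l, i.succ < l → δ l = 0) → B δ = 0 := by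
    constructor
    · intro hall δ hδ hs
      exact (h.adPow_mem_iff hA i δ hs).1 (hall _ (proper δ hs) ((lex _ _).2 hδ))
    · intro hall β hβ hlt
      obtain ⟨δ, rfl, hs⟩ := split β hβ
      exact (h.adPow_mem_iff hA i δ hs).2 (hall δ ((lex _ _).1 hlt) hs)
  have hleast : IsLeastIndex i.succ p (γ + Pi.single i.succ 1) ↔
      mixedPartial γ q 0 ≠ 0 ∧ ∀ δ, LexLT δ γ → mixedPartial δ q 0 = 0 := by
    constructor
    · rintro ⟨⟨-, hne⟩, hmin⟩
      rw [hpq] at hne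
      refine ⟨hne, fun δ hδ => ?_⟩
      by_contra hδne
      have hs : ∀ l, i.succ < l → δ l = 0 := by
        by_contra hs
        exact hδne (h.mixedPartial_eq_zero i hs)
      rw [← lex, lexLT_iff] at hδ
      have := hmin _ ⟨proper δ hs, by rwa [hpq]⟩ (fun e => hδ.ne (congrArg toLex e))
      exact lt_asymm hδ ((lexLT_iff _ _).1 this)
    · rintro ⟨hne, hlow⟩
      refine ⟨⟨proper γ hγ, by rwa [hpq]⟩, fun β hβ hβne => ?_⟩
      obtain ⟨δ, rfl, hs⟩ := split β hβ.1
      have hδ := hβ.2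
      rw [hpq] at hδ
      rw [lex, lexLT_iff]
      refine (lt_trichotomy (toLex γ) (toLex δ)).resolve_right ?_
      rintro (e | hlt)
      · exact hβne (by rw [toLex_inj.1 e])
      · exact hδ (hlow δ ((lexLT_iff _ _).2 hlt))
  rw [hbr, hleast]
  constructor
  · rintro ⟨hne, hlow⟩
    have hlow' := hBlow γ hlow
    exact ⟨fun e => hne ((hB γ hlow').2 e), hlow'⟩
  · rintro ⟨hne, hlow⟩
    refine ⟨fun e => hne ((hB γ hlow).1 e), fun δ hδ _ => ?_⟩
    refine (hB δ fun ε hε => hlow ε ?_).2 (hlow δ hδ)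
    rw [lexLT_iff] at *
    exact hε.trans hδ

end Criterion

section Transport

open VectorField

variable {n m : ℕ} {S : OpenPartialHomeomorph (Fin n → ℝ) (Fin n → ℝ)}

/-! ### Local changes of coordinates -/

lemma IsCoordChange.symm (hS : IsCoordChange S) : IsCoordChange S.symm where
  zero_mem := by
    have := S.map_source hS.zero_mem
    rwa [hS.map_zero] at this
  map_zero := by
    have := S.left_inv hS.zero_mem
    rwa [hS.map_zero] at this
  smooth := hS.smooth_symm
  smooth_symm := hS.smooth

lemma IsCoordChange.source_mem (hS : IsCoordChange S) : ∀ᶠ x in 𝓝 0, x ∈ S.source :=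
  S.open_source.mem_nhds hS.zero_mem

lemma IsCoordChange.smoothNear (hS : IsCoordChange S) : SmoothNear S := by
  filter_upwards [hS.source_mem] with x hx
  exact hS.smooth.contDiffAt (S.open_source.mem_nhds hx)

lemma IsCoordChange.map_nhds (hS : IsCoordChange S) : map S (𝓝 0) = 𝓝 0 := by
  rw [S.map_nhds_eq hS.zero_mem, hS.map_zero]

lemma IsCoordChange.eventually_comp_iff (hS : IsCoordChange S) {P : (Fin n → ℝ) → Prop} :
    (∀ᶠ x in 𝓝 0, P (S x)) ↔ ∀ᶠ y in 𝓝 0, P y := by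
  conv_rhs => rw [← hS.map_nhds]
  exact eventually_map.symm

lemma IsCoordChange.fderiv_symm_comp (hS : IsCoordChange S) :
    ∀ᶠ x in 𝓝 0, (fderiv ℝ S.symm (S x)) ∘L (fderiv ℝ S x) = .id ℝ _ := by
  filter_upwards [hS.smoothNear.differentiableAt,
    hS.eventually_comp_iff.2 hS.symm.smoothNear.differentiableAt,
    hS.source_mem.eventually_nhds] with x hx hx' hs
  rw [← fderiv_comp x hx' hx]
  have e : S.symm ∘ S =ᶠ[𝓝 x] id := hs.mono fun y hy => S.left_inv hy
  rw [e.fderiv_eq, fderiv_id]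

lemma IsCoordChange.fderiv_comp_symm (hS : IsCoordChange S) :
    ∀ᶠ x in 𝓝 0, (fderiv ℝ S x) ∘L (fderiv ℝ S.symm (S x)) = .id ℝ _ := by
  filter_upwards [hS.eventually_comp_iff.2 hS.symm.fderiv_symm_comp, hS.source_mem] with x hx hs
  rwa [S.left_inv hs, S.symm_symm] at hx

lemma IsCoordChange.isInvertible (hS : IsCoordChange S) :
    ∀ᶠ x in 𝓝 0, (fderiv ℝ S x).IsInvertible := by
  filter_upwards [hS.fderiv_symm_comp, hS.fderiv_comp_symm] with x h1 h2
  exact ContinuousLinearMap.IsInvertible.of_inverse h2 h1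

lemma IsCoordChange.pullback_apply (hS : IsCoordChange S) :
    ∀ᶠ x in 𝓝 0, ∀ V, pullback ℝ S V x = fderiv ℝ S.symm (S x) (V (S x)) := by
  filter_upwards [hS.isInvertible, hS.fderiv_comp_symm] with x h1 h2 V
  rw [pullback, h1.inverse_apply_eq, ← ContinuousLinearMap.comp_apply, h2]
  rfl

lemma IsCoordChange.pullback_pullback (hS : IsCoordChange S)
    (V : (Fin n → ℝ) → (Fin n → ℝ)) : pullback ℝ S (pullback ℝ S.symm V) =ᶠ[𝓝 0] V := by
  filter_upwards [hS.pullback_apply, hS.eventually_comp_iff.2 hS.symm.pullback_apply,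
    hS.fderiv_symm_comp, hS.source_mem] with x h1 h2 h3 hs
  rw [h1, h2, S.symm_symm, S.left_inv hs, ← ContinuousLinearMap.comp_apply, h3]
  rfl

lemma IsCoordChange.smoothNear_pullback (hS : IsCoordChange S) {V : (Fin n → ℝ) → (Fin n → ℝ)}
    (hV : SmoothNear V) : SmoothNear (pullback ℝ S V) := by
  filter_upwards [hS.isInvertible, hS.smoothNear, hS.smoothNear.fderiv,
    hS.eventually_comp_iff.2 hV] with x hi hs hd hv
  obtain ⟨e, he⟩ := hi
  have h1 : ContDiffAt ℝ ∞ (fun y => (fderiv ℝ S y).inverse) x := by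
    refine ContDiffAt.comp x (g := ContinuousLinearMap.inverse) ?_ hd
    rw [← he]
    exact contDiffAt_map_inverse e
  exact h1.clm_apply (ContDiffAt.comp x hv hs)

lemma IsCoordChange.pullback_lieBracket (hS : IsCoordChange S)
    {V W : (Fin n → ℝ) → (Fin n → ℝ)} (hV : SmoothNear V) (hW : SmoothNear W) :
    pullback ℝ S (lieBracket ℝ V W) =ᶠ[𝓝 0] lieBracket ℝ (pullback ℝ S V) (pullback ℝ S W) := by
  filter_upwards [hS.smoothNear, hS.eventually_comp_iff.2 hV.differentiableAt,
    hS.eventually_comp_iff.2 hW.differentiableAt] with x hx hv hw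
  exact VectorField.pullback_lieBracket (n := ∞)
    (by rw [minSmoothness_of_isRCLikeNormedField]; exact two_le_infty) hx hv hw

/-- The pullback of a distribution under a map. -/
def pullbackDist (S : (Fin n → ℝ) → (Fin n → ℝ)) (D : (Fin n → ℝ) → Submodule ℝ (Fin n → ℝ))
    (x : Fin n → ℝ) : Submodule ℝ (Fin n → ℝ) :=
  (D (S x)).comap (fderiv ℝ S x : (Fin n → ℝ) →ₗ[ℝ] (Fin n → ℝ))

lemma IsCoordChange.pullback_mem_iff (hS : IsCoordChange S) :
    ∀ᶠ x in 𝓝 0, ∀ V D, pullback ℝ S V x ∈ pullbackDist S D x ↔ V (S x) ∈ D (S x) := by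
  filter_upwards [hS.isInvertible] with x hx V D
  simp [pullbackDist, pullback, hx.self_apply_inverse]

lemma IsCoordChange.sectionNear_iff (hS : IsCoordChange S) {V : (Fin n → ℝ) → (Fin n → ℝ)}
    {D : (Fin n → ℝ) → Submodule ℝ (Fin n → ℝ)} :
    SectionNear (pullback ℝ S V) (pullbackDist S D) ↔ SectionNear V D := by
  unfold SectionNear
  rw [← hS.eventually_comp_iff (P := fun y => V y ∈ D y)]
  exact eventually_congr (hS.pullback_mem_iff.mono fun x hx => hx V D)

lemma SectionNear.congr {V W : (Fin n → ℝ) → (Fin n → ℝ)}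
    {D : (Fin n → ℝ) → Submodule ℝ (Fin n → ℝ)} (h : SectionNear V D) (e : V =ᶠ[𝓝 0] W) :
    SectionNear W D := by
  filter_upwards [h, e] with x hx ex
  rwa [← ex]

lemma comap_span_eq_of_isInvertible {L : (Fin n → ℝ) →L[ℝ] (Fin n → ℝ)} (hL : L.IsInvertible)
    (s : Set (Fin n → ℝ)) :
    (Submodule.span ℝ s).comap (L : (Fin n → ℝ) →ₗ[ℝ] (Fin n → ℝ)) =
      Submodule.span ℝ (L.inverse '' s) := by
  have e : L.inverse '' s = (L.inverse : (Fin n → ℝ) →ₗ[ℝ] (Fin n → ℝ)) '' s := rfl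
  rw [e, ← Submodule.map_span]
  ext v
  simp only [Submodule.mem_comap, Submodule.mem_map]
  refine ⟨fun h => ⟨_, h, hL.inverse_apply_self v⟩, ?_⟩
  rintro ⟨w, hw, rfl⟩
  simpa [hL.self_apply_inverse] using hw

lemma IsCoordChange.pullbackDist_eq_span (hS : IsCoordChange S) :
    ∀ᶠ x in 𝓝 0, ∀ D s, D (S x) = Submodule.span ℝ s →
      pullbackDist S D x = Submodule.span ℝ ((fderiv ℝ S x).inverse '' s) := by
  filter_upwards [hS.isInvertible] with x hx D s hs
  rw [pullbackDist, hs, comap_span_eq_of_isInvertible hx]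

lemma IsCoordChange.isInvolutiveDistribution (hS : IsCoordChange S) {r : ℕ}
    {D : (Fin n → ℝ) → Submodule ℝ (Fin n → ℝ)} (hD : IsInvolutiveDistribution r D) :
    IsInvolutiveDistribution r (pullbackDist S D) where
  frame := by
    obtain ⟨V, hV, hVD⟩ := hD.frame
    refine ⟨fun j => pullback ℝ S (V j), fun j => hS.smoothNear_pullback (hV j), ?_⟩
    filter_upwards [hS.eventually_comp_iff.2 hVD, hS.pullbackDist_eq_span, hS.isInvertible]
      with x hx hs hi
    refine ⟨?_, ?_⟩
    · exact hx.1.map' ((fderiv ℝ S x).inverse : (Fin n → ℝ) →ₗ[ℝ] (Fin n → ℝ))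
        (LinearMap.ker_eq_bot.2 hi.inverse.injective)
    · rw [hs D _ hx.2, ← Set.range_comp]
      rfl
  involutive := by
    intro V W hV hW sV sW
    -- Involutivity concerns arbitrary sections; each is the pullback of its own push-forward.
    have key : ∀ {Z : (Fin n → ℝ) → (Fin n → ℝ)}, SectionNear Z (pullbackDist S D) →
        SectionNear (pullback ℝ S.symm Z) D := fun hZ =>
      hS.sectionNear_iff.1 (hZ.congr (hS.pullback_pullback _).symm)
    have hV' := hS.symm.smoothNear_pullback hV
    have hW' := hS.symm.smoothNear_pullback hW
    refine (hS.sectionNear_iff.2 (hD.involutive _ _ hV' hW' (key sV) (key sW))).congr ?_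
    exact (hS.pullback_lieBracket hV' hW').trans
      ((hS.pullback_pullback V).lieBracket_vectorField (hS.pullback_pullback W))

/-! ### Transport of adapted data -/

variable {S : OpenPartialHomeomorph (Fin (m + 1) → ℝ) (Fin (m + 1) → ℝ)}
  {F G F' G' : (Fin (m + 1) → ℝ) → (Fin (m + 1) → ℝ)}
  {D : Fin (m + 2) → (Fin (m + 1) → ℝ) → Submodule ℝ (Fin (m + 1) → ℝ)}
  {X Y : Fin (m + 1) → (Fin (m + 1) → ℝ) → (Fin (m + 1) → ℝ)}

lemma IsCoordChange.hatD_eq (hS : IsCoordChange S) (hF : SmoothNear F)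
    (eF : F' =ᶠ[𝓝 0] pullback ℝ S F) (eG : G' =ᶠ[𝓝 0] pullback ℝ S G)
    {Γ : Fin m → (Fin (m + 1) → ℝ) → (Fin (m + 1) → ℝ)} (hΓ : ∀ i, SmoothNear (Γ i)) :
    ∀ᶠ x in 𝓝 0, ∀ l, hatD F' G' (fun i => pullback ℝ S (Γ i)) l x =
      pullbackDist S (hatD F G Γ l) x := by
  have hb : ∀ᶠ x in 𝓝 0, ∀ j, lieBracket ℝ (pullback ℝ S (Γ j)) F' x =
      (fderiv ℝ S x).inverse (lieBracket ℝ (Γ j) F (S x)) := eventually_all.2 fun j =>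
    (EventuallyEq.rfl.lieBracket_vectorField eF).trans (hS.pullback_lieBracket (hΓ j) hF).symm
  filter_upwards [hb, eG, hS.pullbackDist_eq_span] with x hb hG hs l
  rw [hs _ _ rfl, hatD, Set.image_union, Set.image_singleton, hG]
  congr 2
  ext v
  constructor
  · rintro ⟨j, hj, rfl⟩
    exact ⟨_, ⟨j, hj, rfl⟩, (hb j).symm⟩
  · rintro ⟨_, ⟨j, hj, rfl⟩, rfl⟩
    exact ⟨j, hj, (hb j).symm⟩

theorem IsCoordChange.isSystemFlag (hS : IsCoordChange S) (hF : SmoothNear F)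
    (eF : F' =ᶠ[𝓝 0] pullback ℝ S F) (eG : G' =ᶠ[𝓝 0] pullback ℝ S G)
    (hD : IsSystemFlag F G D) : IsSystemFlag F' G' fun l => pullbackDist S (D l) where
  involutive l := hS.isInvolutiveDistribution (hD.involutive l)
  bot := by
    filter_upwards [hS.eventually_comp_iff.2 hD.bot, hS.isInvertible] with x hx hi
    rw [pullbackDist, hx, Submodule.comap_bot]
    exact LinearMap.ker_eq_bot.2 hi.injective
  input := by
    filter_upwards [hS.eventually_comp_iff.2 hD.input, hS.pullbackDist_eq_span, eG]
      with x hx hs hG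
    rw [hs _ _ hx, Set.image_singleton, hG]
    rfl
  step := by
    obtain ⟨Γ, hΓ⟩ := hD.step
    refine ⟨fun i => pullback ℝ S (Γ i), fun i => ?_⟩
    obtain ⟨hs, hsec, hnsec, O, hO, hOcl, hOD⟩ := hΓ i
    refine ⟨hS.smoothNear_pullback hs, hS.sectionNear_iff.2 hsec,
      fun h => hnsec (hS.sectionNear_iff.1 h), ?_⟩
    obtain ⟨W, hW, hWo, h0⟩ := eventually_nhds_iff.1
      ((hS.hatD_eq hF eF eG fun i => (hΓ i).1).and hS.source_mem)
    refine ⟨W ∩ (S.source ∩ S ⁻¹' O), hWo.inter (S.isOpen_inter_preimage hO), ?_, ?_⟩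
    · have hcl : ∀ᶠ y in 𝓝 (0 : Fin (m + 1) → ℝ), y ∈ closure O := hOcl
      filter_upwards [hS.eventually_comp_iff.2 hcl, hWo.mem_nhds h0] with x hx hxW
      rw [mem_closure_iff_nhds]
      intro V hV
      have hxs := (hW x hxW).2
      have hN : S '' (V ∩ (W ∩ S.source)) ∈ 𝓝 (S x) := by
        rw [← S.map_nhds_eq hxs]
        exact image_mem_map (inter_mem hV
          (inter_mem (hWo.mem_nhds hxW) (S.open_source.mem_nhds hxs)))
      obtain ⟨_, ⟨z, hz, rfl⟩, hzO⟩ := mem_closure_iff_nhds.1 hx _ hN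
      exact ⟨z, hz.1, hz.2.1, hz.2.2, hzO⟩
    · rintro x ⟨hxW, -, hxO⟩
      rw [(hW x hxW).1, pullbackDist, hOD _ hxO]
      rfl

theorem IsCoordChange.isAdapted (hS : IsCoordChange S) (hF : SmoothNear F)
    (eF : F' =ᶠ[𝓝 0] pullback ℝ S F) (eG : G' =ᶠ[𝓝 0] pullback ℝ S G)
    (hA : IsAdapted F G D X Y) :
    IsAdapted F' G' (fun l => pullbackDist S (D l)) (fun l => pullback ℝ S (X l))
      (fun k => pullback ℝ S (Y k)) where
  flag := hS.isSystemFlag hF eF eG hA.flag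
  smooth_X l := hS.smoothNear_pullback (hA.smooth_X l)
  X_mem l := hS.sectionNear_iff.2 (hA.X_mem l)
  X_notMem l := by
    rw [hS.pullback_mem_iff.self_of_nhds, hS.map_zero]
    exact hA.X_notMem l
  smooth_Y l := hS.smoothNear_pullback (hA.smooth_Y l)
  span_Y k := by
    filter_upwards [hS.eventually_comp_iff.2 (hA.span_Y k), hS.pullbackDist_eq_span] with x hx hs
    rw [hs _ _ hx]
    congr 1
    ext v
    constructor
    · rintro ⟨_, ⟨j, hj, rfl⟩, rfl⟩
      exact ⟨j, hj, rfl⟩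
    · rintro ⟨j, hj, rfl⟩
      exact ⟨_, ⟨j, hj, rfl⟩, rfl⟩
  bracket l k hkl := (hS.sectionNear_iff.2 (hA.bracket l k hkl)).congr
    (hS.pullback_lieBracket (hA.smooth_X l) (hA.smooth_Y k))

theorem IsCoordChange.bracketCondition_iff (hS : IsCoordChange S) (hF : SmoothNear F)
    (eF : F' =ᶠ[𝓝 0] pullback ℝ S F) (hY : ∀ k, SmoothNear (Y k))
    (α : Fin m → Fin (m + 1) → ℕ) :
    BracketCondition F' (fun l => pullbackDist S (D l)) (fun k => pullback ℝ S (Y k)) α ↔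
      BracketCondition F D Y α := by
  have key : ∀ β l, adPow (fun k => pullback ℝ S (Y k)) β F' 0 ∈ pullbackDist S (D l) 0 ↔
      adPow Y β F 0 ∈ D l 0 := by
    intro β l
    have hrel := iterOp_rel (Rel := fun Z Z' => SmoothNear Z ∧ Z' =ᶠ[𝓝 0] pullback ℝ S Z)
      (S := fun k => lieBracket ℝ (Y k)) (R := fun k => lieBracket ℝ (pullback ℝ S (Y k)))
      (fun k Z Z' h => ⟨(hY k).lieBracket h.1,
        (EventuallyEq.rfl.lieBracket_vectorField h.2).trans
          (hS.pullback_lieBracket (hY k) h.1).symm⟩) β ⟨hF, eF⟩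
    rw [adPow_eq_iterOp, hrel.2.self_of_nhds, hS.pullback_mem_iff.self_of_nhds, hS.map_zero,
      adPow_eq_iterOp]
  simp only [BracketCondition, key]

/-! ### The criterion -/

lemma isLeastIndex_congr {k : Fin n} {p q : (Fin n → ℝ) → ℝ} (h : p =ᶠ[𝓝 0] q)
    (α : Fin n → ℕ) : IsLeastIndex k p α ↔ IsLeastIndex k q α := by
  have e : properIndices k p = properIndices k q := by
    ext β
    simp only [properIndices, Set.mem_ofPred_eq, (mixedPartial_congr h β).self_of_nhds]
  rw [IsLeastIndex, IsLeastIndex, e]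

/-- In the coordinates that transform a system into a lower triangular form by feedback, the system
itself is lower triangular, and has the same right-hand sides except for the last one. -/
lemma isLowerTriangular_pullback {f g : (Fin (m + 1) → ℝ) → (Fin (m + 1) → ℝ)}
    (hF : SmoothNear F) (hG : SmoothNear G) (h : IsLowerTriangular f g)
    {T : OpenPartialHomeomorph (Fin (m + 1) → ℝ) (Fin (m + 1) → ℝ)} (hT : IsCoordChange T)
    {a b : (Fin (m + 1) → ℝ) → ℝ} (hb : SmoothNear b) (hb0 : b 0 ≠ 0)
    (he : ∀ᶠ ξ in 𝓝 0,
      fderiv ℝ T ξ (F ξ + a ξ • G ξ) = f (T ξ) ∧ fderiv ℝ T ξ (b ξ • G ξ) = g (T ξ)) :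
    IsLowerTriangular (pullback ℝ T.symm F) (pullback ℝ T.symm G) ∧
      ∀ i : Fin m, (fun x => pullback ℝ T.symm F x i.castSucc) =ᶠ[𝓝 0]
        fun x => f x i.castSucc := by
  have hS := hT.symm
  have hsm := hS.smoothNear_pullback hF
  have hbn : ∀ᶠ ξ in 𝓝 0, b ξ ≠ 0 := hb.self_of_nhds.continuousAt.eventually_ne hb0
  have hrel : ∀ᶠ x in 𝓝 0,
      pullback ℝ T.symm F x + a (T.symm x) • pullback ℝ T.symm G x = f x ∧
      b (T.symm x) • pullback ℝ T.symm G x = g x ∧ b (T.symm x) ≠ 0 := by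
    filter_upwards [hS.pullback_apply, hS.eventually_comp_iff.2 he, hS.source_mem,
      hS.eventually_comp_iff.2 hbn] with x hp hx hs hne
    rw [T.right_inv hs] at hx
    rw [T.symm_symm] at hp
    rw [hp, hp, ← map_smul, ← map_smul, ← map_add]
    exact ⟨hx.1, hx.2, hne⟩
  -- Since `b` does not vanish, the transformed `G` inherits the zeros of `g`; the feedback term
  -- then drops out of all components but the last.
  have hG0 : ∀ i : Fin m, ∀ᶠ x in 𝓝 0, pullback ℝ T.symm G x i.castSucc = 0 := by
    intro i
    filter_upwards [hrel, h.g_eq_zero i] with x hx hg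
    have := congrFun hx.2.1 i.castSucc
    rw [hg, Pi.smul_apply, smul_eq_mul] at this
    exact (mul_eq_zero.1 this).resolve_left hx.2.2
  have hFf : ∀ i : Fin m, (fun x => pullback ℝ T.symm F x i.castSucc) =ᶠ[𝓝 0]
      fun x => f x i.castSucc := by
    intro i
    filter_upwards [hrel, hG0 i] with x hx hg
    simpa [hg] using congrFun hx.1 i.castSucc
  refine ⟨⟨hsm, hS.smoothNear_pullback hG, fun i => ?_, fun i => ?_, hG0, fun h0 => ?_⟩, hFf⟩
  · obtain ⟨U, hU, hdep⟩ := h.depends i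
    refine ⟨_, inter_mem hU (hFf i), fun x hx y hy hxy => ?_⟩
    have ex : pullback ℝ T.symm F x i.castSucc = f x i.castSucc := hx.2
    have ey : pullback ℝ T.symm F y i.castSucc = f y i.castSucc := hy.2
    rw [ex, ey]
    exact hdep x hx.1 y hy.1 hxy
  · obtain ⟨U, hU, hnd⟩ := h.nondegenerate i
    refine ⟨_, inter_mem hU (partialDeriv_congr (hFf i) i.succ), fun V hV hVo hne => ?_⟩
    obtain ⟨x, hx, hxne⟩ := hnd V (fun y hy => (hV hy).1) hVo hne
    refine ⟨x, hx, ?_⟩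
    have ex : partialDeriv i.succ (fun y => pullback ℝ T.symm F y i.castSucc) x =
      partialDeriv i.succ (fun y => f y i.castSucc) x := (hV hx).2
    rwa [ex]
  · apply h.g_last
    rw [← hrel.self_of_nhds.2.1, Pi.smul_apply, h0, smul_zero]

/-- The right-hand condition does not mention the adapted data, so all choices give the same
verdict. Existence, pulled back from the coordinate fields, keeps the "for all" version from being
vacuous. -/
theorem adapted_criterion {f g : (Fin (m + 1) → ℝ) → (Fin (m + 1) → ℝ)}
    (hF : SmoothNear F) (hG : SmoothNear G) (h : IsLowerTriangular f g)
    (hfe : FeedbackEquivalent F G f g) {α : Fin m → Fin (m + 1) → ℕ}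
    (hα : ∀ i : Fin m, IsProper i.succ (α i)) :
    (∃ D X Y, IsAdapted F G D X Y) ∧
      ∀ D X Y, IsAdapted F G D X Y → (BracketCondition F D Y α ↔
        ∀ i : Fin m, IsLeastIndex i.succ (fun x => f x i.castSucc) (α i)) := by
  obtain ⟨T, a, b, hT, -, hb, hb0, he⟩ := hfe
  obtain ⟨hLT, hFf⟩ := isLowerTriangular_pullback hF hG h hT hb hb0 he
  have hS := hT.symm
  refine ⟨⟨_, _, _, hT.isAdapted (hS.smoothNear_pullback hF) (hT.pullback_pullback F).symm
    (hT.pullback_pullback G).symm hLT.isAdapted⟩, fun D X Y hA => ?_⟩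
  rw [← hS.bracketCondition_iff hF EventuallyEq.rfl hA.smooth_Y,
    hLT.bracketCondition_iff (hS.isAdapted hF EventuallyEq.rfl EventuallyEq.rfl hA) hα]
  exact forall_congr' fun i => isLeastIndex_congr (hFf i) _

end Transport

end LTF

end

theorem mainTheorem11 {m : ℕ} (F G : (Fin (m + 1) → ℝ) → (Fin (m + 1) → ℝ))
    (hF : LTF.SmoothNear F) (hG : LTF.SmoothNear G) (hF0 : F 0 = 0)
    (hG0 : ∃ j, G 0 j ≠ 0)
    (α : Fin m → Fin (m + 1) → ℕ) (hα : ∀ i : Fin m, LTF.IsProper i.succ (α i)) :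
    (LTF.EquivalentToType F G α ↔
      LTF.Triangularizable F G ∧
        ∀ D X Y, LTF.IsAdapted F G D X Y → LTF.BracketCondition F D Y α) ∧
    (LTF.EquivalentToType F G α ↔
      LTF.Triangularizable F G ∧
        ∃ D X Y, LTF.IsAdapted F G D X Y ∧ LTF.BracketCondition F D Y α) := by
  refine ⟨⟨?_, ?_⟩, ⟨?_, ?_⟩⟩
  · rintro ⟨f, g, h, hL, hfe⟩
    obtain ⟨-, hc⟩ := LTF.adapted_criterion hF hG h hfe hα
    exact ⟨⟨f, g, h, hfe⟩, fun D X Y hA => (hc D X Y hA).2 hL⟩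
  · rintro ⟨⟨f, g, h, hfe⟩, hall⟩
    obtain ⟨⟨D, X, Y, hA⟩, hc⟩ := LTF.adapted_criterion hF hG h hfe hα
    exact ⟨f, g, h, (hc D X Y hA).1 (hall D X Y hA), hfe⟩
  · rintro ⟨f, g, h, hL, hfe⟩
    obtain ⟨⟨D, X, Y, hA⟩, hc⟩ := LTF.adapted_criterion hF hG h hfe hα
    exact ⟨⟨f, g, h, hfe⟩, D, X, Y, hA, (hc D X Y hA).2 hL⟩
  · rintro ⟨⟨f, g, h, hfe⟩, D, X, Y, hA, hB⟩
    obtain ⟨-, hc⟩ := LTF.adapted_criterion hF hG h hfe hα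
    exact ⟨f, g, h, (hc D X Y hA).1 hB, hfe⟩
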